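/- Let $L=\mathbb{Z}^2$. For $x=(\alpha,\beta)$ put $x^\perp=(\beta,-\alpha)$, and for $0\ne x\in L$ put $\gcd(x)=\gcd(|\alpha|,|\beta|)$ and $\bar x=x/\gcd(x)$. Let $\Omega\subset\mathbb{R}^2$ be a convex lattice polygon with $N\ge 3$ vertices $v_1,\dots,v_N\in L$ listed counterclockwise (indices modulo $N$), with facets $S_i=\mathrm{conv}\{v_i,v_{i+1}\}$, outward Miller normals $\bar n_i=\bar m_i^\perp$ where $m_i=v_{i+1}-v_i$, and outward unit normals $n_i=\bar n_i/|\bar n_i|$. Let $\bar n=\bar n_i$ on $S_i$ (except at the vertices), and let $$\delta(\Omega)=\min\{\mathrm{dist}(v_i,S_j): v_i\notin S_j\}.$$ Let $R\subset L\setminus\{0\}$ be finite with $R=-R$ and $|w|<\delta(\Omega)$ for all $w\in R$. For $w\in R$ let $\varphi_w\colon(0,\infty)\to\mathbb{R}$ be arbitrary functions with $\varphi_w=\varphi_{-w}$. For a real $2\times2$ matrix $F$ with $\det F>0$ define the energy of the homogeneous deformation $y(x)=Fx$, $$E\{\Omega,y\}=\frac12\sum_{x\in\Omega\cap L}\ \sum_{w\in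 R,\ x+w\in\Omega\cap L}\varphi_w(|Fw|),$$ and, for $0\neq\bar m\in L$ and unit vectors $n,m\in\mathbb{R}^2$, $$W(F)=\frac12\sum_{w\in R}\varphi_w(|Fw|),\qquad \gamma_\diamond(F,\bar m)=-\frac14\sum_{w\in R}\frac{1}{|\bar m|}\left(|w\cdot\bar m|-1\right)\varphi_w(|Fw|),$$ $$\tau(F,n,m)=\frac12\sum_{w\in R}\Big\{\Big[H_{n,m}(w)-\frac{1}{2\pi}\theta(n,m)\Big](\gcd(w)-1)+H_{n,m}(w)N_T(w,n,m)\Big\}\varphi_w(|Fw|).$$ Here $H_{n,m}(w)=1$ if $(w\cdot n)(w\cdot m)<0$ and $H_{n,m}(w)=0$ otherwise, $\theta(n,m)\in[0,\pi]$ is the angle between $n$ and $m$, and, when $(w\cdot n)(w\cdot m)<0$ and $n,m$ are not parallel, $$N_T(w,n,m)=s\big(q\cdot\bar w^\perp,\;q\cdot u^\perp,\;\gcd(w)\big),\qquad q=\frac{m\cdot w}{m\cdot n^\perp}\,n^\perp,$$ where $u\in L$ is any vector with $\bar w\cdot u^\perp=1$ (so that $\{u,\bar w\}$ is a basis of $L$),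 $s(0,\beta,k)=0$, and for $\alpha\ne0$ $$s(\alpha,\beta,k)=(\lceil|\alpha|\rceil-1)(k-1)+\sum_{j=1}^{\lceil|\alpha|\rceil-1}\left(\left\lceil\frac{\beta-k}{|\alpha|}j\right\rceil-\left\lfloor\frac{\beta}{|\alpha|}j\right\rfloor\right).$$ Then, exactly, $$E\{\Omega,y\}=\int_\Omega W(F)\,dx+\int_{\partial\Omega}\gamma_\diamond(F,\bar n)\,ds+\sum_{i=1}^N\tau(F,n_i,n_{i-1}).$$ Moreover, for every $i$ and every $w\in R$ with $(w\cdot n_i)(w\cdot n_{i-1})<0$, the number $N_T(w,n_i,n_{i-1})$ is the number of points of $L$ in the interior of the triangle $\mathrm{conv}\{0,w,q\}$, whose apex $q$ is determined by $q\cdot n_i=0$ and $(q-w)\cdot n_{i-1}=0$. -/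

import Mathlib

open MeasureTheory

noncomputable section

namespace BondCounting

/-- The Euclidean plane. -/
abbrev Plane : Type := EuclideanSpace ℝ (Fin 2)

/-- The lattice `L = ℤ²`. -/
abbrev LatVec : Type := Fin 2 → ℤ

/-- The inclusion of the lattice in the plane. -/
def toPlane (w : LatVec) : Plane := WithLp.toLp 2 (fun k => (w k : ℝ))

/-- `(α, β)^⊥ = (β, -α)`: rotation by a right angle, clockwise. -/
def perp (x : Plane) : Plane := !₂[x 1, -x 0]

/-- `(α, β)^⊥ = (β, -α)` for lattice vectors. -/
def latPerp (w : LatVec) : LatVec := ![w 1, -w 0]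

/-- `gcd (α, β) = gcd (|α|, |β|)`. -/
def latGcd (w : LatVec) : ℕ := Int.gcd (w 0) (w 1)

/-- The primitive vector `w̄ = w / gcd w` (the division is exact). -/
def prim (w : LatVec) : LatVec := fun k => w k / (latGcd w : ℤ)

/-- The determinant of two lattice vectors; it is positive when `b` points to the left of `a`. -/
def cross (a b : LatVec) : ℤ := a 0 * b 1 - a 1 * b 0

section Polygon

variable {N : ℕ}

/-- The lattice points `v i`, with indices taken cyclically modulo `N`, are the vertices, listed
counterclockwise and without repetition, of a convex polygon with `N ≥ 3` vertices: every vertex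
other than `v i` and `v (i + 1)` lies strictly to the left of the directed line from `v i` to
`v (i + 1)`. -/
def IsConvexLatticePolygon (v : ZMod N → LatVec) : Prop :=
  3 ≤ N ∧ ∀ i j : ZMod N, j ≠ i → j ≠ i + 1 → 0 < cross (v (i + 1) - v i) (v j - v i)

/-- The region `Ω`: the convex hull of the vertices. -/
def region (v : ZMod N → LatVec) : Set Plane := convexHull ℝ (Set.range fun i => toPlane (v i))

/-- The facet `S_i`, from `v i` to `v (i + 1)`. -/
def facet (v : ZMod N → LatVec) (i : ZMod N) : Set Plane :=
  segment ℝ (toPlane (v i)) (toPlane (v (i + 1)))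

/-- The Miller normal of the facet `S_i`, `(m̄_i)^⊥` with `m_i = v (i + 1) - v i`. It points
outwards because the vertices are listed counterclockwise. -/
def miller (v : ZMod N → LatVec) (i : ZMod N) : LatVec := latPerp (prim (v (i + 1) - v i))

/-- The outward unit normal of the facet `S_i`. -/
def unitNormal (v : ZMod N → LatVec) (i : ZMod N) : Plane :=
  ‖toPlane (miller v i)‖⁻¹ • toPlane (miller v i)

/-- `δ(Ω)`: the least distance of a vertex from a facet that does not contain it. The infimum is
over a finite family, which is nonempty when there are at least three vertices. -/
def delta (v : ZMod N → LatVec) : ℝ :=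
  ⨅ p : {p : ZMod N × ZMod N // toPlane (v p.1) ∉ facet v p.2},
    Metric.infDist (toPlane (v p.1.1)) (facet v p.1.2)

end Polygon

/-- `|F w|`, the length of the deformed bond vector. -/
def bondLength (F : Matrix (Fin 2) (Fin 2) ℝ) (w : LatVec) : ℝ :=
  ‖(WithLp.toLp 2 (F.mulVec fun k => (w k : ℝ)) : Plane)‖

open Classical in
/-- The energy of the homogeneous deformation `y(x) = F x` of `Ω` with bond range `R`:
half of the sum of `φ_w(|F w|)` over the lattice points `x` of `Ω` and over the `w` in `R` with
`x + w` in `Ω`. -/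
def energy (R : Finset LatVec) (φ : LatVec → ℝ → ℝ) (F : Matrix (Fin 2) (Fin 2) ℝ)
    (Ω : Set Plane) : ℝ :=
  1 / 2 * ∑ᶠ x ∈ {x : LatVec | toPlane x ∈ Ω},
    ∑ w ∈ R with toPlane (x + w) ∈ Ω, φ w (bondLength F w)

/-- The stored energy function `W(F)`. -/
def storedEnergy (R : Finset LatVec) (φ : LatVec → ℝ → ℝ) (F : Matrix (Fin 2) (Fin 2) ℝ) : ℝ :=
  1 / 2 * ∑ w ∈ R, φ w (bondLength F w)

/-- The surface energy density `γ_⋄(F, m)`, for a lattice vector `m`. -/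
def surfaceDensity (R : Finset LatVec) (φ : LatVec → ℝ → ℝ) (F : Matrix (Fin 2) (Fin 2) ℝ)
    (m : LatVec) : ℝ :=
  -(1 / 4) * ∑ w ∈ R, 1 / ‖toPlane m‖ * (|inner ℝ (toPlane w) (toPlane m)| - 1) *
    φ w (bondLength F w)

open Classical in
/-- The sector step function `H_{n,m}(w)`. -/
def sectorStep (n m : Plane) (w : LatVec) : ℝ :=
  if inner ℝ (toPlane w) n * inner ℝ (toPlane w) m < 0 then 1 else 0

/-- The apex `q` of the triangle over the base from `0` to `w`: the solution of `q · n = 0`,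
`(q - w) · m = 0` (for `n`, `m` not parallel). -/
def apex (w : LatVec) (n m : Plane) : Plane :=
  (inner ℝ m (toPlane w) / inner ℝ m (perp n)) • perp n

/-- The triangle `T(w, n, m)` with vertices `0`, `w` and `q`. -/
def triangle (w : LatVec) (n m : Plane) : Set Plane :=
  convexHull ℝ {0, toPlane w, apex w n m}

open Classical in
/-- The explicit number of lattice points interior to the triangle with vertices `(0, 0)`,
`(0, k)` and `(α, β)`. -/
def triangleSum (α β : ℝ) (k : ℤ) : ℝ :=
  if α = 0 then 0
  else ((⌈|α|⌉ - 1) * (k - 1) +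
    ∑ j ∈ Finset.Icc (1 : ℤ) (⌈|α|⌉ - 1),
      (⌈(β - (k : ℝ)) / |α| * (j : ℝ)⌉ - ⌊β / |α| * (j : ℝ)⌋) : ℤ)

/-- `N_T(w, n, m) = s(q · w̄^⊥, q · u^⊥, gcd w)`, where `u` is a lattice vector that completes the
primitive vector `w̄` to a basis of the lattice. -/
def triangleCount (u w : LatVec) (n m : Plane) : ℝ :=
  triangleSum (inner ℝ (apex w n m) (toPlane (latPerp (prim w))))
    (inner ℝ (apex w n m) (toPlane (latPerp u))) (latGcd w)

/-- The vertex energy function `τ(F, n, m)`; `u w` completes `w̄` to a basis of the lattice. -/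
def vertexEnergy (R : Finset LatVec) (φ : LatVec → ℝ → ℝ) (u : LatVec → LatVec)
    (F : Matrix (Fin 2) (Fin 2) ℝ) (n m : Plane) : ℝ :=
  1 / 2 * ∑ w ∈ R,
    ((sectorStep n m w - 1 / (2 * Real.pi) * InnerProductGeometry.angle n m) *
        ((latGcd w : ℝ) - 1) +
      sectorStep n m w * triangleCount (u w) w n m) * φ w (bondLength F w)

end BondCounting

end

open BondCounting

/-!
The proof counts bonds one direction `w` at a time. Every energy term is linear in the values
`φ w (bondLength F w)`, so it suffices to show that the number of lattice points `x` with `x` and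
`x + w` in the polygon is
`area + ½ ∑ i (gcd mᵢ - |w × mᵢ|) + 1 - gcd w + ∑ i Hᵢ (gcd w - 1 + N_T,i)`, where `mᵢ` is the
`i`-th facet vector and `Hᵢ` the sector step function at `v i` (`bondCount_eq`). The `1 - gcd w`
turns into the angle terms because the exterior angles of a convex polygon add up to `2π`
(`sum_angle`), and `gcd mᵢ` is the length of the `i`-th facet in units of its Miller normal.

Let `g = gcd w`. A unimodular change of coordinates makes `w` equal to `(g, 0)`, so that bonds lie in
the rows of lattice points on horizontal lines. Shifting a row of `n` points by `g` leaves
`max (n - g) 0 = (n - g) + max (g - n) 0` of them in the row (`ncard_shift`). It remains to evaluate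
three sums over the rows.

* The sum of the `n` is the number of lattice points, given by Pick's theorem (`pick`). In a convex
  polygon every horizontal strip between neighbouring lattice lines is crossed by exactly one
  ascending and one descending facet (`sum_up`, `sum_down`), so the trapezoidal sum of the row counts
  minus the slice lengths splits into sums of fractional parts along single facets, which average to
  `½` by point symmetry, up to the lattice points on the facet (`sum_range_floor_sub`).
* The sum of the `g` is `g` times the number of rows, and the height of a closed polygon is half of
  the total variation of the height along its boundary (`sum_abs_height`).
* For the sum of the `max (g - n) 0`, the slice length is a concave function of the height, and the
  assumption `|w| < δ(Ω)` makes the slice through a vertex either a point or longer than `w`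
  (`lt_length_vertex`). Hence short rows occur only near a vertex that is the unique highest or
  lowest point, and there the polygon coincides with its tangent cone, cut off at the width `|w|`:
  this tip is a translate, up to point reflection, of the triangle `T`, and its rows give the
  explicit sum in the definition of `N_T` (`sum_deficit_top`).

The same explicit sum counts the interior lattice points of `T` itself row by row
(`triangleSum_eq_ncard`).
-/

namespace BondCounting

/-! ### Edges, half-planes and facets -/

variable {N : ℕ} {v : ZMod N → LatVec}

@[simp] lemma toPlane_apply (w : LatVec) (k : Fin 2) : toPlane w k = (w k : ℝ) := rfl

lemma plane_ext {p q : Plane} (h0 : p 0 = q 0) (h1 : p 1 = q 1) : p = q := by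
  ext k; fin_cases k <;> assumption

/-- The affine function that vanishes on the line through `v i` and `v (i + 1)` and is positive to
its left. -/
def side (v : ZMod N → LatVec) (i : ZMod N) (p : Plane) : ℝ :=
  ((v (i + 1) 0 : ℝ) - v i 0) * (p 1 - v i 1) - ((v (i + 1) 1 : ℝ) - v i 1) * (p 0 - v i 0)

lemma side_toPlane (i : ZMod N) (x : LatVec) :
    side v i (toPlane x) = (cross (v (i + 1) - v i) (x - v i) : ℤ) := by
  simp [side, cross]

lemma side_combo (i : ZMod N) (p q : Plane) {a b : ℝ} (h : a + b = 1) :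
    side v i (a • p + b • q) = a * side v i p + b * side v i q := by
  obtain rfl : b = 1 - a := by linarith
  simp [side]; ring

lemma side_left (i : ZMod N) : side v i (toPlane (v i)) = 0 := by simp [side]

lemma side_right (i : ZMod N) : side v i (toPlane (v (i + 1))) = 0 := by simp [side]; ring

lemma side_eq_zero_of_mem_facet {i : ZMod N} {p : Plane} (hp : p ∈ facet v i) :
    side v i p = 0 := by
  obtain ⟨a, b, -, -, hab, rfl⟩ := hp
  rw [side_combo i _ _ hab, side_left, side_right]; simp

lemma continuous_side (i : ZMod N) : Continuous (side v i) := by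
  unfold side; fun_prop

namespace IsConvexLatticePolygon

variable (hv : IsConvexLatticePolygon v)
include hv

lemma two_ne_zero : (2 : ZMod N) ≠ 0 := by
  intro h
  have := (ZMod.natCast_eq_zero_iff 2 N).1 (by exact_mod_cast h)
  have := Nat.le_of_dvd (by norm_num) this
  have := hv.1
  omega

lemma add_one_ne (i : ZMod N) : i + 1 ≠ i := by
  intro h
  have h1 : (1 : ZMod N) = 0 := by simpa using h
  apply hv.two_ne_zero
  have : (2 : ZMod N) = 1 + 1 := by norm_num
  rw [this, h1]; simp

lemma add_two_ne (i : ZMod N) : i + 1 + 1 ≠ i := by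
  intro h
  apply hv.two_ne_zero
  have : (2 : ZMod N) = 1 + 1 := by norm_num
  rw [this]
  rw [add_assoc] at h
  simpa using h

lemma side_pos {i j : ZMod N} (h1 : j ≠ i) (h2 : j ≠ i + 1) : 0 < side v i (toPlane (v j)) := by
  rw [side_toPlane]; exact_mod_cast hv.2 i j h1 h2

lemma side_vertex_nonneg (i j : ZMod N) : 0 ≤ side v i (toPlane (v j)) := by
  by_cases h1 : j = i
  · rw [h1, side_left]
  by_cases h2 : j = i + 1
  · rw [h2, side_right]
  exact (hv.side_pos h1 h2).le

lemma eq_or_eq_of_side_eq_zero {i j : ZMod N} (h : side v i (toPlane (v j)) = 0) :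
    j = i ∨ j = i + 1 := by
  by_contra! hc
  exact (hv.side_pos hc.1 hc.2).ne' h

/-- The union of the open half-plane to the left of a facet with the facet is convex, and it
contains all the vertices. -/
lemma side_pos_or_mem_facet {p : Plane} (hp : p ∈ region v) (i : ZMod N) :
    0 < side v i p ∨ p ∈ facet v i := by
  have hconv : Convex ℝ {p : Plane | 0 < side v i p ∨ p ∈ facet v i} := by
    intro x hx y hy a b ha hb hab
    have hx0 : 0 ≤ side v i x := hx.elim le_of_lt fun h => (side_eq_zero_of_mem_facet h).ge
    have hy0 : 0 ≤ side v i y := hy.elim le_of_lt fun h => (side_eq_zero_of_mem_facet h).ge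
    simp only [Set.mem_ofPred_eq]
    rw [side_combo i _ _ hab]
    rcases ha.eq_or_lt with rfl | ha
    · obtain rfl : b = 1 := by linarith
      simpa using hy
    rcases hb.eq_or_lt with rfl | hb
    · obtain rfl : a = 1 := by linarith
      simpa using hx
    rcases hx with hx | hx
    · left; nlinarith [mul_pos ha hx, mul_nonneg hb.le hy0]
    rcases hy with hy | hy
    · left; nlinarith [mul_pos hb hy, mul_nonneg ha.le hx0]
    · right; exact convex_segment _ _ hx hy ha.le hb.le hab
  refine convexHull_min ?_ hconv hp
  rintro _ ⟨j, rfl⟩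
  by_cases h1 : j = i
  · right; rw [h1]; exact left_mem_segment _ _ _
  by_cases h2 : j = i + 1
  · right; rw [h2]; exact right_mem_segment _ _ _
  · left; exact hv.side_pos h1 h2

lemma side_nonneg {p : Plane} (hp : p ∈ region v) (i : ZMod N) : 0 ≤ side v i p :=
  (hv.side_pos_or_mem_facet hp i).elim le_of_lt fun h => (side_eq_zero_of_mem_facet h).ge

/-- Distinct facets do not share interior points. -/
lemma eq_of_mem_openSegment {i j : ZMod N} {p : Plane}
    (hi : p ∈ facet v i)
    (hj : p ∈ openSegment ℝ (toPlane (v j)) (toPlane (v (j + 1)))) : i = j := by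
  have h0 := side_eq_zero_of_mem_facet hi
  obtain ⟨a, b, ha, hb, hab, rfl⟩ := hj
  rw [side_combo i _ _ hab] at h0
  have h1 := hv.side_vertex_nonneg i j
  have h2 := hv.side_vertex_nonneg i (j + 1)
  have e1 : side v i (toPlane (v j)) = 0 := by
    by_contra h
    have := h1.lt_of_ne' h
    nlinarith [mul_pos ha this, mul_nonneg hb.le h2]
  have e2 : side v i (toPlane (v (j + 1))) = 0 := by
    by_contra h
    have := h2.lt_of_ne' h
    nlinarith [mul_pos hb this, mul_nonneg ha.le h1]
  rcases hv.eq_or_eq_of_side_eq_zero e1 with h | h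
  · exact h.symm
  rcases hv.eq_or_eq_of_side_eq_zero e2 with h' | h'
  · rw [h] at h'; exact absurd h' (hv.add_two_ne i)
  · exact (add_right_cancel h').symm

lemma neg : IsConvexLatticePolygon (-v) := by
  refine ⟨hv.1, fun i j h1 h2 => ?_⟩
  have := hv.2 i j h1 h2
  simp only [cross, Pi.sub_apply, Pi.neg_apply] at this ⊢
  linarith

end IsConvexLatticePolygon

lemma vertex_mem_region (i : ZMod N) : toPlane (v i) ∈ region v :=
  subset_convexHull _ _ ⟨i, rfl⟩

lemma convex_region : Convex ℝ (region v) := convex_convexHull _ _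

lemma facet_subset_region (i : ZMod N) : facet v i ⊆ region v :=
  convex_region.segment_subset (vertex_mem_region i) (vertex_mem_region (i + 1))

lemma isCompact_region [NeZero N] : IsCompact (region v) :=
  (Set.finite_range _).isCompact_convexHull _

lemma toPlane_neg (x : LatVec) : toPlane (-x) = -toPlane x := by
  apply plane_ext <;> simp

lemma toPlane_add (x y : LatVec) : toPlane (x + y) = toPlane x + toPlane y := by
  apply plane_ext <;> simp

lemma mem_region_neg {p : Plane} : p ∈ region (-v) ↔ -p ∈ region v := by
  have : region (-v) = -region v := by
    have h2 : (Set.range fun i => toPlane ((-v) i)) = -Set.range fun i => toPlane (v i) := by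
      ext x
      simp [toPlane_neg, neg_eq_iff_eq_neg]
    rw [region, region, h2]
    exact convexHull_neg _
  rw [this]; rfl

/-- Going once around, one meets a step at which a property gets lost. -/
lemma exists_step [NeZero N] (p : ZMod N → Prop) {a b : ZMod N} (ha : p a) (hb : ¬ p b) :
    ∃ i, p i ∧ ¬ p (i + 1) := by
  by_contra! h
  have key : ∀ n : ℕ, p (a + n) := by
    intro n
    induction n with
    | zero => simpa using ha
    | succ n ih => have := h _ ih; push_cast; rwa [← add_assoc]
  apply hb
  have := key (b - a).val
  rwa [ZMod.natCast_zmod_val, add_sub_cancel] at this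

/-! ### Horizontal slices -/

/-- The first coordinate of the point at height `t` of the line through `v i` and `v (i + 1)`,
for facets that are not horizontal. -/
noncomputable def edgeX (v : ZMod N → LatVec) (i : ZMod N) (t : ℝ) : ℝ :=
  v i 0 + (t - v i 1) * (((v (i + 1) 0 : ℝ) - v i 0) / ((v (i + 1) 1 : ℝ) - v i 1))

lemma edgeX_mem_segment {i : ZMod N} {t : ℝ} (h1 : (v i 1 : ℝ) ≤ t) (h2 : t ≤ v (i + 1) 1)
    (h : v i 1 < v (i + 1) 1) : !₂[edgeX v i t, t] ∈ facet v i := by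
  have h' : (0:ℝ) < (v (i + 1) 1 : ℝ) - v i 1 := by
    rw [sub_pos]; exact_mod_cast h
  refine ⟨(v (i + 1) 1 - t) / (v (i + 1) 1 - v i 1), (t - v i 1) / (v (i + 1) 1 - v i 1),
    div_nonneg (by linarith) h'.le, div_nonneg (by linarith) h'.le, by field_simp; ring, ?_⟩
  apply plane_ext <;> simp [edgeX] <;> field_simp <;> ring

lemma edgeX_mem_segment' {i : ZMod N} {t : ℝ} (h1 : (v (i + 1) 1 : ℝ) ≤ t) (h2 : t ≤ v i 1)
    (h : v (i + 1) 1 < v i 1) : !₂[edgeX v i t, t] ∈ facet v i := by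
  have h' : (0:ℝ) < (v i 1 : ℝ) - v (i + 1) 1 := by
    rw [sub_pos]; exact_mod_cast h
  have h'' : (v (i + 1) 1 : ℝ) - v i 1 ≠ 0 := by linarith
  refine ⟨(t - v (i + 1) 1) / (v i 1 - v (i + 1) 1), (v i 1 - t) / (v i 1 - v (i + 1) 1),
    div_nonneg (by linarith) h'.le, div_nonneg (by linarith) h'.le, by field_simp; ring, ?_⟩
  apply plane_ext <;> simp [edgeX] <;> field_simp <;> ring

lemma edgeX_mem_openSegment {i : ZMod N} {t : ℝ} (h1 : (v i 1 : ℝ) < t) (h2 : t < v (i + 1) 1) :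
    !₂[edgeX v i t, t] ∈ openSegment ℝ (toPlane (v i)) (toPlane (v (i + 1))) := by
  have h' : (0:ℝ) < (v (i + 1) 1 : ℝ) - v i 1 := by linarith
  refine ⟨(v (i + 1) 1 - t) / (v (i + 1) 1 - v i 1), (t - v i 1) / (v (i + 1) 1 - v i 1),
    div_pos (by linarith) h', div_pos (by linarith) h', by field_simp; ring, ?_⟩
  apply plane_ext <;> simp [edgeX] <;> field_simp <;> ring

lemma edgeX_left (i : ZMod N) : edgeX v i (v i 1) = v i 0 := by simp [edgeX]

lemma edgeX_right (i : ZMod N) (h : v i 1 ≠ v (i + 1) 1) :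
    edgeX v i (v (i + 1) 1) = v (i + 1) 0 := by
  have : (v (i + 1) 1 : ℝ) - v i 1 ≠ 0 := by
    rw [sub_ne_zero]; exact_mod_cast h.symm
  simp only [edgeX]; field_simp; ring

lemma edgeX_neg (i : ZMod N) (t : ℝ) : edgeX (-v) i (-t) = -edgeX v i t := by
  have : (v i 1 : ℝ) - v (i + 1) 1 = -(v (i + 1) 1 - v i 1) := by ring
  have h2 : (v i 0 : ℝ) - v (i + 1) 0 = -(v (i + 1) 0 - v i 0) := by ring
  simp only [edgeX, Pi.neg_apply, Int.cast_neg, neg_sub_neg]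
  rw [this, h2, neg_div_neg_eq]
  ring

namespace IsConvexLatticePolygon

variable (hv : IsConvexLatticePolygon v)
include hv

lemma le_edgeX {i : ZMod N} (h : v i 1 < v (i + 1) 1) {p : Plane} (hp : p ∈ region v) :
    p 0 ≤ edgeX v i (p 1) := by
  have h' : (0:ℝ) < (v (i + 1) 1 : ℝ) - v i 1 := by
    rw [sub_pos]; exact_mod_cast h
  have := hv.side_nonneg hp i
  rw [side] at this
  rw [edgeX, ← sub_le_iff_le_add', mul_div_assoc', le_div_iff₀ h']
  linarith

lemma edgeX_le {i : ZMod N} (h : v (i + 1) 1 < v i 1) {p : Plane} (hp : p ∈ region v) :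
    edgeX v i (p 1) ≤ p 0 := by
  have h1 := hv.neg.le_edgeX (i := i) (by simpa using h) (p := -p)
    (mem_region_neg.2 (by simpa using hp))
  rw [PiLp.neg_apply, PiLp.neg_apply, edgeX_neg] at h1
  linarith

/-- Over a horizontal strip of height one there is at most one ascending facet. -/
lemma up_unique {i j : ZMod N} {t : ℤ} (hi : v i 1 ≤ t) (hi' : t < v (i + 1) 1)
    (hj : v j 1 ≤ t) (hj' : t < v (j + 1) 1) : i = j := by
  have ci : (v i 1 : ℝ) ≤ t := by exact_mod_cast hi
  have cj : (v j 1 : ℝ) ≤ t := by exact_mod_cast hj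
  have ci' : (t : ℝ) + 1 ≤ v (i + 1) 1 := by exact_mod_cast hi'
  have cj' : (t : ℝ) + 1 ≤ v (j + 1) 1 := by exact_mod_cast hj'
  -- at half-integral height both facets contain the right end of the slice in their interior
  have mi := edgeX_mem_segment (v := v) (i := i) (t := t + 1 / 2) (by linarith) (by linarith)
    (by omega)
  have mj := edgeX_mem_openSegment (v := v) (i := j) (t := t + 1 / 2) (by linarith) (by linarith)
  have mj' := openSegment_subset_segment _ _ _ mj
  have e1 := hv.le_edgeX (i := j) (by omega) (facet_subset_region _ mi)
  have e2 := hv.le_edgeX (i := i) (by omega) (facet_subset_region _ mj')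
  simp only [Matrix.cons_val_zero, Matrix.cons_val_one] at e1 e2
  rw [le_antisymm e1 e2] at mi
  exact hv.eq_of_mem_openSegment mi mj

lemma down_unique {i j : ZMod N} {t : ℤ} (hi : v (i + 1) 1 ≤ t) (hi' : t < v i 1)
    (hj : v (j + 1) 1 ≤ t) (hj' : t < v j 1) : i = j := by
  apply hv.neg.up_unique (t := -t - 1) <;> simp only [Pi.neg_apply] <;> omega

end IsConvexLatticePolygon

/-- The least height of a vertex. -/
def lowest [NeZero N] (v : ZMod N → LatVec) : ℤ :=
  Finset.univ.inf' Finset.univ_nonempty fun i => v i 1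

/-- The greatest height of a vertex. -/
def highest [NeZero N] (v : ZMod N → LatVec) : ℤ :=
  Finset.univ.sup' Finset.univ_nonempty fun i => v i 1

/-- The right end of the horizontal slice of the region at height `t`. -/
noncomputable def rightEnd (v : ZMod N → LatVec) (t : ℝ) : ℝ := sSup {s | !₂[s, t] ∈ region v}

/-- The left end of the horizontal slice of the region at height `t`. -/
noncomputable def leftEnd (v : ZMod N → LatVec) (t : ℝ) : ℝ := sInf {s | !₂[s, t] ∈ region v}

lemma leftEnd_neg (t : ℝ) : leftEnd (-v) (-t) = -rightEnd v t := by
  rw [leftEnd, rightEnd, Real.sInf_def]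
  congr 2
  ext s
  have : -!₂[-s, -t] = !₂[s, t] := by apply plane_ext <;> simp
  rw [Set.mem_neg, Set.mem_ofPred_eq, Set.mem_ofPred_eq, mem_region_neg, this]

lemma rightEnd_neg (t : ℝ) : rightEnd (-v) (-t) = -leftEnd v t := by
  have := leftEnd_neg (v := -v) (-t)
  rw [neg_neg, neg_neg] at this
  linarith

section Heights

variable [NeZero N]

lemma lowest_le (i : ZMod N) : lowest v ≤ v i 1 :=
  Finset.inf'_le (fun i => v i 1) (Finset.mem_univ i)

lemma le_highest (i : ZMod N) : v i 1 ≤ highest v :=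
  Finset.le_sup' (fun i => v i 1) (Finset.mem_univ i)

variable (v) in
lemma exists_eq_lowest : ∃ i, v i 1 = lowest v := by
  obtain ⟨i, -, h⟩ := Finset.exists_mem_eq_inf' Finset.univ_nonempty fun i => v i 1
  exact ⟨i, h.symm⟩

variable (v) in
lemma exists_eq_highest : ∃ i, v i 1 = highest v := by
  obtain ⟨i, -, h⟩ := Finset.exists_mem_eq_sup' Finset.univ_nonempty fun i => v i 1
  exact ⟨i, h.symm⟩

lemma highest_neg : highest (-v) = -lowest v := by
  obtain ⟨i, hi⟩ := exists_eq_highest (-v)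
  obtain ⟨j, hj⟩ := exists_eq_lowest v
  have h1 := lowest_le (v := v) i
  have h2 := le_highest (v := -v) j
  simp only [Pi.neg_apply] at hi h2
  omega

lemma lowest_neg : lowest (-v) = -highest v := by
  have := highest_neg (v := -v)
  rw [neg_neg] at this
  omega

lemma height_mem {p : Plane} (hp : p ∈ region v) : (lowest v : ℝ) ≤ p 1 ∧ p 1 ≤ highest v := by
  have hconv : Convex ℝ {p : Plane | (lowest v : ℝ) ≤ p 1 ∧ p 1 ≤ highest v} := by
    rintro x ⟨h1, h2⟩ y ⟨h3, h4⟩ a b ha hb hab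
    obtain rfl : b = 1 - a := by linarith
    constructor <;> simp <;> nlinarith
  refine convexHull_min ?_ hconv hp
  rintro _ ⟨i, rfl⟩
  exact ⟨Int.cast_le.2 (lowest_le i), Int.cast_le.2 (le_highest i)⟩

lemma exists_up_strip {t : ℤ} (h1 : lowest v ≤ t) (h2 : t < highest v) :
    ∃ i, v i 1 ≤ t ∧ t < v (i + 1) 1 := by
  obtain ⟨a, ha⟩ := exists_eq_lowest v
  obtain ⟨b, hb⟩ := exists_eq_highest v
  obtain ⟨i, hi, hi'⟩ := exists_step (fun i => v i 1 ≤ t) (a := a) (b := b) (by omega) (by omega)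
  exact ⟨i, hi, by omega⟩

lemma exists_down_strip {t : ℤ} (h1 : lowest v ≤ t) (h2 : t < highest v) :
    ∃ i, v (i + 1) 1 ≤ t ∧ t < v i 1 := by
  obtain ⟨i, hi, hi'⟩ := exists_up_strip (v := -v) (t := -t - 1) (by rw [lowest_neg]; omega)
    (by rw [highest_neg]; omega)
  simp only [Pi.neg_apply] at hi hi'
  exact ⟨i, by omega, by omega⟩

end Heights

namespace IsConvexLatticePolygon

variable (hv : IsConvexLatticePolygon v)
include hv

lemma rightEnd_eq {i : ZMod N} (h : v i 1 < v (i + 1) 1) {t : ℝ} (h1 : (v i 1 : ℝ) ≤ t)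
    (h2 : t ≤ v (i + 1) 1) : rightEnd v t = edgeX v i t := by
  refine IsGreatest.csSup_eq ⟨facet_subset_region _ (edgeX_mem_segment h1 h2 h), ?_⟩
  intro s hs
  simpa using hv.le_edgeX h hs

lemma leftEnd_eq {i : ZMod N} (h : v (i + 1) 1 < v i 1) {t : ℝ} (h1 : (v (i + 1) 1 : ℝ) ≤ t)
    (h2 : t ≤ v i 1) : leftEnd v t = edgeX v i t := by
  refine IsLeast.csInf_eq ⟨facet_subset_region _ (edgeX_mem_segment' h1 h2 h), ?_⟩
  intro s hs
  simpa using hv.edgeX_le h hs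

/-- In the cone spanned at a vertex by the two adjacent facets, heights are bounded by the height of
the vertex if both facets point downwards. -/
lemma le_height_of_side_nonneg {i : ZMod N} (h1 : v (i - 1) 1 ≤ v i 1) (h2 : v (i + 1) 1 ≤ v i 1)
    {p : Plane} (hp1 : 0 ≤ side v (i - 1) p) (hp2 : 0 ≤ side v i p) : p 1 ≤ v i 1 := by
  have e : i - 1 + 1 = i := sub_add_cancel i 1
  have h := hv.side_pos (i := i - 1) (j := i + 1)
    (by intro h; apply hv.add_two_ne (i - 1); rw [e, h]) (by rw [e]; exact hv.add_one_ne i)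
  have h1' : (v (i - 1) 1 : ℝ) ≤ v i 1 := by exact_mod_cast h1
  have h2' : (v (i + 1) 1 : ℝ) ≤ v i 1 := by exact_mod_cast h2
  simp only [side, e, toPlane_apply] at h hp1 hp2
  have key : 0 ≤ (((v i 0 : ℝ) - v (i - 1) 0) * (v (i + 1) 1 - v (i - 1) 1) -
      (v i 1 - v (i - 1) 1) * (v (i + 1) 0 - v (i - 1) 0)) * (v i 1 - p 1) := by
    nlinarith [mul_nonneg (sub_nonneg.2 h1') hp2, mul_nonneg (sub_nonneg.2 h2') hp1]
  have := nonneg_of_mul_nonneg_right key h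
  linarith

variable [NeZero N]

lemma lowest_lt_highest : lowest v < highest v := by
  by_contra! h
  have h' : ∀ i, v i 1 = lowest v := fun i => by
    have := lowest_le (v := v) i
    have := le_highest (v := v) i
    omega
  have := hv.2 0 (0 + 1 + 1) (hv.add_two_ne 0) (hv.add_one_ne _)
  simp [cross, h'] at this

lemma exists_up {t : ℝ} (h1 : lowest v ≤ t) (h2 : t ≤ highest v) :
    ∃ i, v i 1 < v (i + 1) 1 ∧ (v i 1 : ℝ) ≤ t ∧ t ≤ v (i + 1) 1 := by
  obtain ⟨a, ha⟩ := exists_eq_lowest v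
  obtain ⟨b, hb⟩ := exists_eq_highest v
  rcases h2.lt_or_eq with h | rfl
  · obtain ⟨i, hi, hi'⟩ := exists_step (fun i => (v i 1 : ℝ) ≤ t) (a := a) (b := b)
      (by simpa [ha] using h1) (by simpa [hb] using h)
    rw [not_le] at hi'
    exact ⟨i, by exact_mod_cast hi.trans_lt hi', hi, hi'.le⟩
  · obtain ⟨i, hi, hi'⟩ := exists_step (fun i => v i 1 < highest v) (a := a) (b := b)
      (by have := hv.lowest_lt_highest; omega) (by omega)
    exact ⟨i, by omega, by exact_mod_cast hi.le, by exact_mod_cast not_lt.1 hi'⟩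

lemma exists_down {t : ℝ} (h1 : lowest v ≤ t) (h2 : t ≤ highest v) :
    ∃ i, v (i + 1) 1 < v i 1 ∧ (v (i + 1) 1 : ℝ) ≤ t ∧ t ≤ v i 1 := by
  obtain ⟨i, h3, h4, h5⟩ := hv.neg.exists_up (t := -t) (by rw [lowest_neg]; push_cast; linarith)
    (by rw [highest_neg]; push_cast; linarith)
  simp only [Pi.neg_apply, Int.cast_neg, neg_le_neg_iff, neg_lt_neg_iff] at h3 h4 h5
  exact ⟨i, h3, h5, h4⟩

/-- The region at a given height is the interval between an ascending and a descending facet. -/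
lemma mem_region_iff {s t : ℝ} (h1 : lowest v ≤ t) (h2 : t ≤ highest v) :
    !₂[s, t] ∈ region v ↔ leftEnd v t ≤ s ∧ s ≤ rightEnd v t := by
  obtain ⟨i, hi, hi1, hi2⟩ := hv.exists_up h1 h2
  obtain ⟨j, hj, hj1, hj2⟩ := hv.exists_down h1 h2
  rw [hv.rightEnd_eq hi hi1 hi2, hv.leftEnd_eq hj hj1 hj2]
  constructor
  · intro hp
    exact ⟨by simpa using hv.edgeX_le hj hp, by simpa using hv.le_edgeX hi hp⟩
  · rintro ⟨hl, hr⟩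
    have mi := facet_subset_region _ (edgeX_mem_segment hi1 hi2 hi)
    have mj := facet_subset_region _ (edgeX_mem_segment' hj1 hj2 hj)
    rcases (hl.trans hr).eq_or_lt with h | h
    · rwa [le_antisymm hr (h ▸ hl)]
    · have h' : edgeX v i t - edgeX v j t ≠ 0 := by linarith
      convert convex_region mj mi
        (a := (edgeX v i t - s) / (edgeX v i t - edgeX v j t))
        (b := (s - edgeX v j t) / (edgeX v i t - edgeX v j t))
        (div_nonneg (by linarith) (by linarith)) (div_nonneg (by linarith) (by linarith))
        (by field_simp; ring) using 1
      apply plane_ext <;> simp <;> field_simp <;> ring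

lemma leftEnd_le_rightEnd {t : ℝ} (h1 : lowest v ≤ t) (h2 : t ≤ highest v) :
    leftEnd v t ≤ rightEnd v t := by
  obtain ⟨i, hi, hi1, hi2⟩ := hv.exists_up h1 h2
  have := (hv.mem_region_iff h1 h2).1 (facet_subset_region _ (edgeX_mem_segment hi1 hi2 hi))
  exact this.1.trans this.2

/-- The length of the horizontal slices is concave: it is at least `c` between two heights at
which it is at least `c`. -/
lemma le_length_of_le_of_le {c t₁ t t₂ : ℝ} (h₁ : lowest v ≤ t₁) (h₂ : t₂ ≤ highest v)
    (ht₁ : t₁ ≤ t) (ht₂ : t ≤ t₂) (hc₁ : c ≤ rightEnd v t₁ - leftEnd v t₁)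
    (hc₂ : c ≤ rightEnd v t₂ - leftEnd v t₂) : c ≤ rightEnd v t - leftEnd v t := by
  rcases (ht₁.trans ht₂).eq_or_lt with h | h
  · obtain rfl : t₁ = t := le_antisymm ht₁ (h ▸ ht₂)
    exact hc₁
  have l₁ : t₁ ≤ highest v := by linarith
  have l₂ : lowest v ≤ t₂ := by linarith
  have d : 0 < t₂ - t₁ := by linarith
  have e₁ := hv.leftEnd_le_rightEnd h₁ l₁
  have e₂ := hv.leftEnd_le_rightEnd l₂ h₂
  have r := (hv.mem_region_iff (by linarith) (by linarith)).1 <| show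
    !₂[(t₂ - t) / (t₂ - t₁) * rightEnd v t₁ + (t - t₁) / (t₂ - t₁) * rightEnd v t₂, t] ∈ _ by
    convert convex_region ((hv.mem_region_iff h₁ l₁).2 ⟨e₁, le_rfl⟩)
      ((hv.mem_region_iff l₂ h₂).2 ⟨e₂, le_rfl⟩)
      (a := (t₂ - t) / (t₂ - t₁)) (b := (t - t₁) / (t₂ - t₁))
      (div_nonneg (by linarith) d.le) (div_nonneg (by linarith) d.le) (by field_simp; ring) using 1
    apply plane_ext <;> simp
    field_simp; ring
  have l := (hv.mem_region_iff (by linarith) (by linarith)).1 <| show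
    !₂[(t₂ - t) / (t₂ - t₁) * leftEnd v t₁ + (t - t₁) / (t₂ - t₁) * leftEnd v t₂, t] ∈ _ by
    convert convex_region ((hv.mem_region_iff h₁ l₁).2 ⟨le_rfl, e₁⟩)
      ((hv.mem_region_iff l₂ h₂).2 ⟨le_rfl, e₂⟩)
      (a := (t₂ - t) / (t₂ - t₁)) (b := (t - t₁) / (t₂ - t₁))
      (div_nonneg (by linarith) d.le) (div_nonneg (by linarith) d.le) (by field_simp; ring) using 1
    apply plane_ext <;> simp
    field_simp; ring
  have hab : (t₂ - t) / (t₂ - t₁) + (t - t₁) / (t₂ - t₁) = 1 := by field_simp; ring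
  have ha : 0 ≤ (t₂ - t) / (t₂ - t₁) := div_nonneg (by linarith) d.le
  have hb : 0 ≤ (t - t₁) / (t₂ - t₁) := div_nonneg (by linarith) d.le
  generalize (t₂ - t) / (t₂ - t₁) = a at *
  generalize (t - t₁) / (t₂ - t₁) = b at *
  obtain rfl : b = 1 - a := by linarith
  nlinarith [mul_le_mul_of_nonneg_left hc₁ ha, mul_le_mul_of_nonneg_left hc₂ hb, r.2, l.1]

/-- Every horizontal strip of height one between two lattice lines is met by exactly one ascending
facet, so that a sum over strips is a sum over ascending facets. -/
lemma sum_up {M : Type*} [AddCommMonoid M] (f : ℤ → M) :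
    ∑ i, ∑ t ∈ Finset.Ico (v i 1) (v (i + 1) 1), f t =
      ∑ t ∈ Finset.Ico (lowest v) (highest v), f t := by
  rw [← Finset.sum_biUnion]
  · congr 1
    ext t
    simp only [Finset.mem_biUnion, Finset.mem_univ, true_and, Finset.mem_Ico]
    constructor
    · rintro ⟨i, h1, h2⟩
      exact ⟨(lowest_le i).trans h1, h2.trans_le (le_highest _)⟩
    · rintro ⟨h1, h2⟩
      exact exists_up_strip h1 h2
  · intro i _ j _ hij
    rw [Function.onFun, Finset.disjoint_left]
    intro t hi hj
    rw [Finset.mem_Ico] at hi hj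
    exact hij (hv.up_unique hi.1 hi.2 hj.1 hj.2)

lemma sum_down {M : Type*} [AddCommMonoid M] (f : ℤ → M) :
    ∑ i, ∑ t ∈ Finset.Ico (v (i + 1) 1) (v i 1), f t =
      ∑ t ∈ Finset.Ico (lowest v) (highest v), f t := by
  rw [← Finset.sum_biUnion]
  · congr 1
    ext t
    simp only [Finset.mem_biUnion, Finset.mem_univ, true_and, Finset.mem_Ico]
    constructor
    · rintro ⟨i, h1, h2⟩
      exact ⟨(lowest_le _).trans h1, h2.trans_le (le_highest _)⟩
    · rintro ⟨h1, h2⟩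
      exact exists_down_strip h1 h2
  · intro i _ j _ hij
    rw [Function.onFun, Finset.disjoint_left]
    intro t hi hj
    rw [Finset.mem_Ico] at hi hj
    exact hij (hv.down_unique hi.1 hi.2 hj.1 hj.2)

/-- The vertical extent of a closed polygon is half of the sum of the extents of its facets. -/
lemma sum_abs_height :
    ∑ i, |v (i + 1) 1 - v i 1| = 2 * (highest v - lowest v) := by
  have h1 := hv.sum_up (fun _ => (1 : ℤ))
  have h2 := hv.sum_down (fun _ => (1 : ℤ))
  have h := hv.lowest_lt_highest
  simp only [Finset.sum_const, Int.card_Ico, nsmul_eq_mul, mul_one, Int.toNat_sub_of_le h.le]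
    at h1 h2
  rw [two_mul]
  nth_rewrite 1 [← h1]
  rw [← h2, ← Finset.sum_add_distrib]
  refine Finset.sum_congr rfl fun i _ => ?_
  rcases abs_cases (v (i + 1) 1 - v i 1) with h | h <;> omega

end IsConvexLatticePolygon

/-! ### Sums of integer parts along a facet -/

lemma card_filter_dvd_mul {h : ℕ} (hh : 0 < h) (d : ℤ) :
    (({k ∈ Finset.range h | (h : ℤ) ∣ (k : ℤ) * d} : Finset ℕ)).card = Int.gcd d h := by
  set g := Int.gcd d h with hg
  have hgpos : 0 < g := Int.gcd_pos_of_ne_zero_right _ (by exact_mod_cast hh.ne')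
  obtain ⟨h', hh'⟩ : g ∣ h := by exact_mod_cast Int.gcd_dvd_right (a := d) (b := (h : ℤ))
  have hpos : 0 < h' := Nat.pos_of_ne_zero fun h0 => by simp [h0] at hh'; omega
  have hdvd : ∀ k : ℕ, (h : ℤ) ∣ (k : ℤ) * d ↔ h' ∣ k := by
    intro k
    have h1 : (g : ℤ) ∣ d := Int.gcd_dvd_left ..
    obtain ⟨d', hd'⟩ := h1
    have hcop : Int.gcd d' h' = 1 := by
      have : g * Int.gcd d' h' = g := by
        rw [hh', hd'] at hg
        push_cast at hg
        rw [Int.gcd_mul_left] at hg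
        simpa using hg.symm
      exact Nat.eq_of_mul_eq_mul_left hgpos (by simpa using this)
    have : (h : ℤ) ∣ (k : ℤ) * d ↔ (h' : ℤ) ∣ k * d' := by
      have e1 : (h : ℤ) = g * h' := by exact_mod_cast hh'
      have e2 : (k : ℤ) * d = g * (k * d') := by rw [hd']; ring
      rw [e1, e2]
      exact mul_dvd_mul_iff_left (by exact_mod_cast hgpos.ne')
    rw [this]
    constructor
    · intro hk
      have := Int.dvd_of_dvd_mul_left_of_gcd_one hk (by rw [Int.gcd_comm]; exact hcop)
      exact_mod_cast this
    · intro hk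
      exact Dvd.dvd.mul_right (by exact_mod_cast hk) _
  have : ({k ∈ Finset.range h | (h : ℤ) ∣ (k : ℤ) * d} : Finset ℕ) =
      (Finset.range g).image (fun j => h' * j) := by
    ext k
    simp only [Finset.mem_filter, Finset.mem_range, Finset.mem_image, hdvd]
    constructor
    · rintro ⟨hk, j, rfl⟩
      refine ⟨j, ?_, rfl⟩
      rw [hh', mul_comm g] at hk
      exact lt_of_mul_lt_mul_left hk (Nat.zero_le _)
    · rintro ⟨j, hj, rfl⟩
      refine ⟨?_, dvd_mul_right _ _⟩
      rw [hh', mul_comm g]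
      exact Nat.mul_lt_mul_of_pos_left hj hpos
  rw [this, Finset.card_image_of_injective _ (mul_right_injective₀ hpos.ne'), Finset.card_range]

/-- The fractional parts along a lattice segment, with half weights at its ends: by the point
symmetry of the segment they average `1 / 2`, except that they vanish at its lattice points. -/
lemma sum_range_floor_sub {h : ℕ} (hh : 0 < h) (d : ℤ) :
    ∑ k ∈ Finset.range h, (((⌊(k : ℝ) * (d / h)⌋ : ℝ) - k * (d / h)) +
      (⌊((k : ℝ) + 1) * (d / h)⌋ - (k + 1) * (d / h))) = Int.gcd d h - h := by
  have hR : (h : ℝ) ≠ 0 := by exact_mod_cast hh.ne'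
  rw [Finset.sum_add_distrib]
  -- reversing the second sum pairs `⌊y⌋` with `⌊d - y⌋ = d - ⌈y⌉`
  rw [← Finset.sum_range_reflect
    (fun k : ℕ => (⌊((k : ℝ) + 1) * (d / h)⌋ - ((k : ℝ) + 1) * (d / h)))]
  rw [← Finset.sum_add_distrib, ← card_filter_dvd_mul hh d, Finset.card_filter]
  have : ((h : ℕ) : ℝ) = ∑ k ∈ Finset.range h, (1 : ℝ) := by simp
  conv_rhs => rw [this]
  push_cast
  rw [← Finset.sum_sub_distrib]
  refine Finset.sum_congr rfl fun k hk => ?_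
  have hk' := Finset.mem_range.1 hk
  have e : ((h - 1 - k : ℕ) : ℝ) + 1 = h - k := by
    rw [Nat.sub_sub, Nat.cast_sub (by omega)]; push_cast; ring
  have e2 : ((h : ℝ) - k) * (d / h) = d + -(k * (d / h)) := by field_simp; ring
  rw [e, e2, Int.floor_intCast_add, Int.floor_neg]
  push_cast
  split_ifs with hd
  · obtain ⟨m, hm⟩ := hd
    have : (k : ℝ) * (d / h) = (m : ℤ) := by
      field_simp
      have : (k : ℝ) * d = h * m := by exact_mod_cast hm
      linarith
    rw [this]; simp
  · have : ⌈(k : ℝ) * (d / h)⌉ = ⌊(k : ℝ) * (d / h)⌋ + 1 := by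
      rw [Int.ceil_eq_floor_add_one_iff_notMem]
      rintro ⟨m, hm⟩
      apply hd
      refine ⟨m, ?_⟩
      field_simp at hm
      have : (k : ℝ) * d = h * m := by linarith
      exact_mod_cast this
    rw [this]; push_cast; ring

lemma sum_Ico_int {M : Type*} [AddCommMonoid M] (f : ℤ → M) (p q : ℤ) :
    ∑ t ∈ Finset.Ico p q, f t = ∑ k ∈ Finset.range (q - p).toNat, f (p + k) := by
  change ∑ t ∈ (Finset.range (q - p).toNat).map _, f t = _
  rw [Finset.sum_map]
  rfl

lemma sum_Ico_floor_sub {p q d X : ℤ} (hpq : p < q) (f : ℝ → ℝ)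
    (hf : ∀ t, f t = X + (t - p) * (d / (q - p))) :
    ∑ t ∈ Finset.Ico p q, (((⌊f t⌋ : ℝ) - f t) + (⌊f (t + 1)⌋ - f (t + 1))) =
      Int.gcd d (q - p) - (q - p) := by
  obtain ⟨h, hh⟩ := Int.eq_ofNat_of_zero_le (sub_nonneg.2 hpq.le)
  have hpos : 0 < h := by omega
  have hR : (q : ℝ) - p = h := by exact_mod_cast hh
  rw [sum_Ico_int, hh, Int.toNat_natCast, hR, ← sum_range_floor_sub hpos d]
  refine Finset.sum_congr rfl fun k _ => ?_
  simp only [hf, hR]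
  push_cast
  rw [show (p : ℝ) + k - p = k by ring, show (p : ℝ) + k + 1 - p = k + 1 by ring,
    Int.floor_intCast_add, Int.floor_intCast_add]
  push_cast
  ring

/-! ### Counting lattice points row by row -/

/-- The number of lattice points of the region at height `t`, for `t` between the least and the
greatest height of a vertex. -/
noncomputable def rowCount (v : ZMod N → LatVec) (t : ℤ) : ℤ :=
  ⌊rightEnd v t⌋ - ⌈leftEnd v t⌉ + 1

lemma rowCount_neg (t : ℤ) : rowCount (-v) (-t) = rowCount v t := by
  simp only [rowCount, Int.cast_neg, leftEnd_neg, rightEnd_neg, Int.floor_neg, Int.ceil_neg]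
  ring

lemma latGcd_neg (x : LatVec) : latGcd (-x) = latGcd x := by simp [latGcd]

section

variable [NeZero N]

lemma finite_lattice_region : {x : LatVec | toPlane x ∈ region v}.Finite := by
  obtain ⟨C, hC⟩ := (isCompact_region (v := v)).isBounded.exists_norm_le
  refine (Set.Finite.pi' (t := fun _ : Fin 2 => Set.Icc (-⌈C⌉) ⌈C⌉)
    fun _ => Set.finite_Icc _ _).subset ?_
  intro x hx k
  have h1 := (PiLp.norm_apply_le (toPlane x) k).trans (hC _ hx)
  rw [toPlane_apply, Real.norm_eq_abs, abs_le] at h1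
  have h2 := Int.le_ceil C
  constructor
  · have : ((-⌈C⌉ : ℤ) : ℝ) ≤ x k := by push_cast; linarith
    exact_mod_cast this
  · have : (x k : ℝ) ≤ ⌈C⌉ := by linarith
    exact_mod_cast this

/-- In a row of `n` consecutive lattice points, `max (n - g) 0` of them stay in the row when they
are shifted by `g`. -/
lemma IsConvexLatticePolygon.ncard_shift (hv : IsConvexLatticePolygon v) (g : ℕ) :
    (({x : LatVec | toPlane x ∈ region v ∧ toPlane (x + ![(g : ℤ), 0]) ∈ region v}.ncard : ℕ) : ℤ) =
      ∑ t ∈ Finset.Icc (lowest v) (highest v), max (rowCount v t - g) 0 := by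
  let S : Finset (Σ _ : ℤ, ℤ) := (Finset.Icc (lowest v) (highest v)).sigma
    fun t => Finset.Icc ⌈leftEnd v t⌉ (⌊rightEnd v t⌋ - g)
  have key : {x : LatVec | toPlane x ∈ region v ∧ toPlane (x + ![(g : ℤ), 0]) ∈ region v} =
      ↑(S.image fun p => (![p.2, p.1] : LatVec)) := by
    ext x
    simp only [Set.mem_ofPred_eq, Finset.coe_image, Set.mem_image, Finset.mem_coe]
    have e1 : toPlane x = !₂[(x 0 : ℝ), ((x 1 : ℤ) : ℝ)] := by apply plane_ext <;> simp
    have e2 : toPlane (x + ![(g : ℤ), 0]) = !₂[(x 0 : ℝ) + g, ((x 1 : ℤ) : ℝ)] := by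
      rw [toPlane_add]
      apply plane_ext <;> simp
    constructor
    · rintro ⟨h1, h2⟩
      have ht := height_mem h1
      rw [toPlane_apply] at ht
      rw [e1, hv.mem_region_iff ht.1 ht.2] at h1
      rw [e2, hv.mem_region_iff ht.1 ht.2] at h2
      refine ⟨⟨x 1, x 0⟩, ?_, ?_⟩
      · simp only [S, Finset.mem_sigma, Finset.mem_Icc]
        refine ⟨⟨Int.cast_le.1 ht.1, Int.cast_le.1 ht.2⟩, Int.ceil_le.2 h1.1, ?_⟩
        have : x 0 + g ≤ ⌊rightEnd v (x 1)⌋ := Int.le_floor.2 (by push_cast; exact h2.2)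
        omega
      · ext k; fin_cases k <;> rfl
    · rintro ⟨⟨t, s⟩, hts, rfl⟩
      simp only [S, Finset.mem_sigma, Finset.mem_Icc] at hts
      obtain ⟨⟨h1, h2⟩, h3, h4⟩ := hts
      have h1' : (lowest v : ℝ) ≤ t := by exact_mod_cast h1
      have h2' : (t : ℝ) ≤ highest v := by exact_mod_cast h2
      have h5 := Int.ceil_le.1 h3
      have h6 : s + g ≤ ⌊rightEnd v t⌋ := by omega
      have h7 := Int.le_floor.1 h6
      push_cast at h7
      have : (0 : ℝ) ≤ g := Nat.cast_nonneg g
      rw [e1, e2]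
      simp only [Matrix.cons_val_zero, Matrix.cons_val_one]
      rw [hv.mem_region_iff h1' h2', hv.mem_region_iff h1' h2']
      exact ⟨⟨h5, by linarith⟩, by linarith, h7⟩
  rw [key, Set.ncard_coe_finset, Finset.card_image_of_injective, Finset.card_sigma]
  · push_cast
    refine Finset.sum_congr rfl fun t _ => ?_
    rw [Int.card_Icc, rowCount]
    omega
  · rintro ⟨t, s⟩ ⟨t', s'⟩ h
    have h0 := congrFun h 0
    have h1 := congrFun h 1
    simp only [Matrix.cons_val_zero, Matrix.cons_val_one] at h0 h1
    simp [h0, h1]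

end

namespace IsConvexLatticePolygon

variable (hv : IsConvexLatticePolygon v)
include hv

lemma sum_rightEnd (i : ZMod N) :
    ∑ t ∈ Finset.Ico (v i 1) (v (i + 1) 1),
      (((⌊rightEnd v t⌋ : ℝ) - rightEnd v t) +
        (⌊rightEnd v (t + 1)⌋ - rightEnd v (t + 1))) =
      if v i 1 < v (i + 1) 1 then
        (latGcd (v (i + 1) - v i) : ℝ) - (v (i + 1) 1 - v i 1) else 0 := by
  split_ifs with h
  · rw [latGcd, Pi.sub_apply, Pi.sub_apply, ← sum_Ico_floor_sub (X := v i 0) h (edgeX v i)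
      (by intro t; rw [edgeX]; push_cast; ring)]
    refine Finset.sum_congr rfl fun t ht => ?_
    rw [Finset.mem_Ico] at ht
    have h1 : (v i 1 : ℝ) ≤ t := by exact_mod_cast ht.1
    have h2 : (t : ℝ) + 1 ≤ v (i + 1) 1 := by exact_mod_cast ht.2
    rw [hv.rightEnd_eq h h1 (by linarith), hv.rightEnd_eq h (by linarith) h2]
  · rw [Finset.Ico_eq_empty h, Finset.sum_empty]

lemma sum_leftEnd (i : ZMod N) :
    ∑ t ∈ Finset.Ico (v (i + 1) 1) (v i 1),
      (((⌊-leftEnd v t⌋ : ℝ) - -leftEnd v t) +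
        (⌊-leftEnd v (t + 1)⌋ - -leftEnd v (t + 1))) =
      if v (i + 1) 1 < v i 1 then
        (latGcd (v (i + 1) - v i) : ℝ) - (v i 1 - v (i + 1) 1) else 0 := by
  split_ifs with h
  · have h' : (v i 1 : ℝ) - v (i + 1) 1 ≠ 0 := by
      rw [sub_ne_zero]; exact_mod_cast h.ne'
    have h'' : (v (i + 1) 1 : ℝ) - v i 1 ≠ 0 := by
      rw [sub_ne_zero]; exact_mod_cast h.ne
    have hg : latGcd (v (i + 1) - v i) = Int.gcd (v (i + 1) 0 - v i 0) (v i 1 - v (i + 1) 1) := by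
      rw [latGcd, Pi.sub_apply, Pi.sub_apply, ← Int.gcd_neg, neg_sub]
    rw [hg, ← sum_Ico_floor_sub (X := -v (i + 1) 0) h (fun t => -edgeX v i t)
      (by intro t; rw [edgeX]; push_cast; field_simp; ring)]
    refine Finset.sum_congr rfl fun t ht => ?_
    rw [Finset.mem_Ico] at ht
    have h1 : (v (i + 1) 1 : ℝ) ≤ t := by exact_mod_cast ht.1
    have h2 : (t : ℝ) + 1 ≤ v i 1 := by exact_mod_cast ht.2
    rw [hv.leftEnd_eq h h1 (by linarith), hv.leftEnd_eq h (by linarith) h2]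
  · rw [Finset.Ico_eq_empty h, Finset.sum_empty]

variable [NeZero N]

/-- The trapezoidal sum of the row counts exceeds that of the slice lengths by the number of lattice
steps on the facets that are not horizontal. -/
lemma sum_Ico_rowCount :
    ∑ t ∈ Finset.Ico (lowest v) (highest v), ((rowCount v t : ℝ) + rowCount v (t + 1)) =
      ∑ t ∈ Finset.Ico (lowest v) (highest v), ((rightEnd v t - leftEnd v t) +
        (rightEnd v (t + 1) - leftEnd v (t + 1))) +
      ∑ i, if v i 1 = v (i + 1) 1 then (0 : ℝ) else latGcd (v (i + 1) - v i) := by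
  have h1 := hv.sum_up fun t : ℤ => (((⌊rightEnd v t⌋ : ℝ) - rightEnd v t) +
        (⌊rightEnd v (t + 1)⌋ - rightEnd v (t + 1)))
  have h2 := hv.sum_down fun t : ℤ => (((⌊-leftEnd v t⌋ : ℝ) - -leftEnd v t) +
        (⌊-leftEnd v (t + 1)⌋ - -leftEnd v (t + 1)))
  simp only [hv.sum_rightEnd, hv.sum_leftEnd] at h1 h2
  have h3 : (∑ i, |(v (i + 1) 1 : ℝ) - v i 1|) = ∑ t ∈ Finset.Ico (lowest v) (highest v), (2 : ℝ) := by
    have := hv.sum_abs_height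
    have h4 : ((∑ i, |v (i + 1) 1 - v i 1| : ℤ) : ℝ) = ((2 * (highest v - lowest v) : ℤ) : ℝ) := by
      rw [this]
    push_cast at h4
    rw [h4, Finset.sum_const, Int.card_Ico, nsmul_eq_mul,
      ← Int.cast_natCast (R := ℝ), Int.toNat_of_nonneg (by have := hv.lowest_lt_highest; omega)]
    push_cast; ring
  have h4 : (∑ i, if v i 1 = v (i + 1) 1 then (0 : ℝ) else latGcd (v (i + 1) - v i)) =
      ∑ i, ((if v i 1 < v (i + 1) 1 then
        (latGcd (v (i + 1) - v i) : ℝ) - (v (i + 1) 1 - v i 1) else 0) +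
        (if v (i + 1) 1 < v i 1 then
        (latGcd (v (i + 1) - v i) : ℝ) - (v i 1 - v (i + 1) 1) else 0) +
        |(v (i + 1) 1 : ℝ) - v i 1|) := by
    refine Finset.sum_congr rfl fun i _ => ?_
    rcases lt_trichotomy (v i 1) (v (i + 1) 1) with h | h | h
    · have h' : (v i 1 : ℝ) < v (i + 1) 1 := by exact_mod_cast h
      rw [if_neg h.ne, if_pos h, if_neg h.not_gt, abs_of_pos (by linarith)]; ring
    · simp [h]
    · have h' : (v (i + 1) 1 : ℝ) < v i 1 := by exact_mod_cast h
      rw [if_neg h.ne', if_neg h.not_gt, if_pos h, abs_of_neg (by linarith)]; ring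
  rw [Finset.sum_add_distrib (s := Finset.univ), Finset.sum_add_distrib (s := Finset.univ), h1, h2,
    h3] at h4
  rw [h4, ← Finset.sum_add_distrib, ← Finset.sum_add_distrib, ← Finset.sum_add_distrib]
  refine Finset.sum_congr rfl fun t _ => ?_
  simp only [rowCount, Int.floor_neg]
  push_cast
  ring

/-- The horizontal facets at the greatest height make up the whole slice there. -/
lemma rowCount_highest :
    (rowCount v (highest v) : ℝ) = 1 + ∑ i, if v i 1 = v (i + 1) 1 ∧ v i 1 = highest v then
      (latGcd (v (i + 1) - v i) : ℝ) else 0 := by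
  have hlt := hv.lowest_lt_highest
  obtain ⟨j, hj, hj'⟩ := exists_up_strip (v := v) (t := highest v - 1) (by omega) (by omega)
  obtain ⟨k, hk, hk'⟩ := exists_down_strip (v := v) (t := highest v - 1) (by omega) (by omega)
  have ej : v (j + 1) 1 = highest v := by have := le_highest (v := v) (j + 1); omega
  have ek : v k 1 = highest v := by have := le_highest (v := v) k; omega
  have hr : rightEnd v (highest v) = v (j + 1) 0 := by
    rw [← ej, hv.rightEnd_eq (by omega) (by exact_mod_cast (by omega)) le_rfl,
      edgeX_right j (by omega)]
  have hl : leftEnd v (highest v) = v k 0 := by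
    rw [← ek, hv.leftEnd_eq (i := k) (by omega) (by exact_mod_cast (by omega)) le_rfl,
      edgeX_left k]
  -- the first coordinates of the vertices at the greatest height, telescoped along the boundary:
  -- horizontal facets contribute their lengths, and the descending facet `k` and the ascending
  -- facet `j` that end there contribute the two ends of the slice
  have tele : ∑ i, ((if v i 1 = highest v then v i 0 else 0) -
      (if v (i + 1) 1 = highest v then v (i + 1) 0 else 0)) = 0 := by
    rw [Finset.sum_sub_distrib, sub_eq_zero]
    exact (Equiv.sum_comp (Equiv.addRight (1 : ZMod N))
      (fun i => if v i 1 = highest v then v i 0 else 0)).symm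
  have hterm : ∀ i, ((if v i 1 = highest v then v i 0 else 0) -
      (if v (i + 1) 1 = highest v then v (i + 1) 0 else 0)) =
      (if v i 1 = v (i + 1) 1 ∧ v i 1 = highest v then (latGcd (v (i + 1) - v i) : ℤ) else 0) +
      (if i = k then v k 0 else 0) - (if i = j then v (j + 1) 0 else 0) := by
    intro i
    have hjk : j ≠ k := by rintro rfl; omega
    by_cases h1 : v i 1 = highest v <;> by_cases h2 : v (i + 1) 1 = highest v
    · have hik : i ≠ k := by rintro rfl; omega
      have hij : i ≠ j := by rintro rfl; omega
      obtain ⟨a, ha⟩ := exists_eq_lowest v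
      have := hv.2 i a (by rintro rfl; omega) (by rintro rfl; omega)
      simp only [cross, Pi.sub_apply, h1, h2, ha, sub_self, zero_mul, sub_zero] at this
      have hneg : v (i + 1) 0 - v i 0 < 0 := by
        by_contra! hc
        nlinarith
      simp only [h1, h2, hik, hij, and_self, if_true, if_false, latGcd, Pi.sub_apply, sub_self,
        Int.gcd_zero_right]
      omega
    · have hik : i = k := hv.down_unique (t := highest v - 1)
        (by have := le_highest (v := v) (i + 1); omega) (by omega) hk hk'
      subst hik
      simp [h1, h2, hjk.symm, Ne.symm h2]
    · have hij : i = j := hv.up_unique (t := highest v - 1)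
        (by have := le_highest (v := v) i; omega) (by omega) hj hj'
      subst hij
      simp [h1, h2, hjk]
    · have hik : i ≠ k := by rintro rfl; exact h1 ek
      have hij : i ≠ j := by rintro rfl; exact h2 ej
      simp [h1, h2, hik, hij]
  rw [Finset.sum_congr rfl fun i _ => hterm i, Finset.sum_sub_distrib, Finset.sum_add_distrib,
    Finset.sum_ite_eq' Finset.univ k, Finset.sum_ite_eq' Finset.univ j] at tele
  simp only [Finset.mem_univ, if_true] at tele
  have : rowCount v (highest v) = 1 + ∑ i, if v i 1 = v (i + 1) 1 ∧ v i 1 = highest v then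
      (latGcd (v (i + 1) - v i) : ℤ) else 0 := by
    rw [rowCount, hr, hl, Int.floor_intCast, Int.ceil_intCast]
    linarith
  rw [this]
  push_cast
  rfl

lemma rowCount_lowest :
    (rowCount v (lowest v) : ℝ) = 1 + ∑ i, if v i 1 = v (i + 1) 1 ∧ v i 1 = lowest v then
      (latGcd (v (i + 1) - v i) : ℝ) else 0 := by
  have := hv.neg.rowCount_highest
  rw [highest_neg, rowCount_neg] at this
  rw [this]
  congr 1
  refine Finset.sum_congr rfl fun i _ => ?_
  have : (-v) (i + 1) - (-v) i = -(v (i + 1) - v i) := by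
    rw [Pi.neg_apply, Pi.neg_apply]; abel
  rw [this, latGcd_neg]
  simp

/-- A horizontal facet lies at the least or at the greatest height. -/
lemma eq_lowest_or_eq_highest {i : ZMod N} (h : v i 1 = v (i + 1) 1) :
    v i 1 = lowest v ∨ v i 1 = highest v := by
  by_contra! hc
  obtain ⟨a, ha⟩ := exists_eq_lowest v
  obtain ⟨b, hb⟩ := exists_eq_highest v
  have h1 := lowest_le (v := v) i
  have h2 := le_highest (v := v) i
  have h3 := hv.2 i a (by rintro rfl; omega) (by rintro rfl; omega)
  have h4 := hv.2 i b (by rintro rfl; omega) (by rintro rfl; omega)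
  simp only [cross, Pi.sub_apply, ← h, sub_self, zero_mul, sub_zero] at h3 h4
  have h5 : v a 1 - v i 1 < 0 := by omega
  have h6 : 0 < v b 1 - v i 1 := by omega
  have := pos_of_mul_pos_left h4 h6.le
  nlinarith

/-- The number of lattice points, in terms of the slice lengths: a discrete form of Pick's
theorem. -/
lemma two_mul_sum_rowCount :
    2 * ∑ t ∈ Finset.Icc (lowest v) (highest v), (rowCount v t : ℝ) =
      ∑ t ∈ Finset.Ico (lowest v) (highest v), ((rightEnd v t - leftEnd v t) +
        (rightEnd v (t + 1) - leftEnd v (t + 1))) +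
      ∑ i, (latGcd (v (i + 1) - v i) : ℝ) + 2 := by
  have hlt := hv.lowest_lt_highest
  have h1 : ∑ t ∈ Finset.Icc (lowest v) (highest v), (rowCount v t : ℝ) =
      ∑ t ∈ Finset.Ico (lowest v) (highest v), (rowCount v t : ℝ) + rowCount v (highest v) := by
    rw [← Finset.Ico_insert_right hlt.le, Finset.sum_insert Finset.right_notMem_Ico, add_comm]
  have h2 : ∑ t ∈ Finset.Icc (lowest v) (highest v), (rowCount v t : ℝ) =
      ∑ t ∈ Finset.Ico (lowest v) (highest v), (rowCount v (t + 1) : ℝ) +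
        rowCount v (lowest v) := by
    rw [← Finset.Ioc_insert_left hlt.le, Finset.sum_insert Finset.left_notMem_Ioc, add_comm]
    congr 1
    refine (Finset.sum_bij (fun t _ => t + 1) ?_ ?_ ?_ ?_).symm
    · intro t; simp only [Finset.mem_Ico, Finset.mem_Ioc]; omega
    · intro s _ t _ h; omega
    · intro t ht
      rw [Finset.mem_Ioc] at ht
      exact ⟨t - 1, by rw [Finset.mem_Ico]; omega, by omega⟩
    · intro t _; rfl
  have h3 := hv.sum_Ico_rowCount
  rw [Finset.sum_add_distrib] at h3
  have h4 : ∑ i, (latGcd (v (i + 1) - v i) : ℝ) =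
      (∑ i, if v i 1 = v (i + 1) 1 then (0 : ℝ) else latGcd (v (i + 1) - v i)) +
      (∑ i, if v i 1 = v (i + 1) 1 ∧ v i 1 = highest v then
        (latGcd (v (i + 1) - v i) : ℝ) else 0) +
      ∑ i, if v i 1 = v (i + 1) 1 ∧ v i 1 = lowest v then
        (latGcd (v (i + 1) - v i) : ℝ) else 0 := by
    rw [← Finset.sum_add_distrib, ← Finset.sum_add_distrib]
    refine Finset.sum_congr rfl fun i _ => ?_
    by_cases h : v i 1 = v (i + 1) 1
    · rcases hv.eq_lowest_or_eq_highest h with h' | h'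
      · have : lowest v ≠ highest v := hlt.ne
        simp [← h, h', this]
      · have : highest v ≠ lowest v := hlt.ne'
        simp [← h, h', this]
    · simp [h]
  have h5 := hv.rowCount_highest
  have h6 := hv.rowCount_lowest
  linarith

end IsConvexLatticePolygon

/-! ### Rows shorter than the bond -/

/-- The segments from a vertex to a facet not containing it that are parallel to `w` are longer
than `w`. In contrast to a bound on `|w|`, this condition is invariant under linear maps. -/
def ShortBond (v : ZMod N → LatVec) (w : LatVec) : Prop :=
  ∀ k j (c : ℝ), toPlane (v k) ∉ facet v j → toPlane (v k) + c • toPlane w ∈ facet v j → 1 < |c|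

/-- The sum `s(α, β, g)` at the vertex `v i`, for the bond `(g, 0)`. -/
noncomputable def tipSum (v : ZMod N → LatVec) (g : ℕ) (i : ZMod N) : ℝ :=
  triangleSum
    (g * (v i - v (i - 1)) 1 * (v (i + 1) - v i) 1 /
      cross (v i - v (i - 1)) (v (i + 1) - v i))
    (-(g * (v i - v (i - 1)) 1 * (v (i + 1) - v i) 0 /
      cross (v i - v (i - 1)) (v (i + 1) - v i))) g

lemma mem_facet_neg {i : ZMod N} {p : Plane} : p ∈ facet (-v) i ↔ -p ∈ facet v i := by
  simp only [facet, Pi.neg_apply, toPlane_neg]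
  constructor
  · rintro ⟨a, b, ha, hb, hab, rfl⟩
    exact ⟨a, b, ha, hb, hab, by simp; abel⟩
  · rintro ⟨a, b, ha, hb, hab, h⟩
    exact ⟨a, b, ha, hb, hab, by rw [← neg_eq_iff_eq_neg.2 h]; simp; abel⟩

lemma ShortBond.neg {w : LatVec} (h : ShortBond v w) : ShortBond (-v) w := by
  intro k j c h1 h2
  rw [mem_facet_neg, Pi.neg_apply, toPlane_neg] at h1 h2
  rw [neg_neg] at h1
  rw [neg_add, neg_neg, ← neg_smul] at h2
  simpa using h k j (-c) h1 h2

lemma tipSum_neg (g : ℕ) (i : ZMod N) : tipSum (-v) g i = tipSum v g i := by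
  have h1 : (-v) i - (-v) (i - 1) = -(v i - v (i - 1)) := by simp only [Pi.neg_apply]; abel
  have h2 : (-v) (i + 1) - (-v) i = -(v (i + 1) - v i) := by simp only [Pi.neg_apply]; abel
  have h3 : ∀ a b : LatVec, cross (-a) (-b) = cross a b := fun a b => by simp [cross]
  rw [tipSum, tipSum, h1, h2, h3]
  generalize v i - v (i - 1) = a
  generalize v (i + 1) - v i = b
  simp

lemma le_rowCount {g : ℕ} {t : ℤ} (h : (g : ℝ) ≤ rightEnd v t - leftEnd v t) :
    (g : ℤ) ≤ rowCount v t := by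
  have h1 := Int.ceil_lt_add_one (leftEnd v t)
  have h2 := Int.lt_floor_add_one (rightEnd v t)
  have : (g : ℝ) < rowCount v t + 1 := by rw [rowCount]; push_cast; linarith
  have : (g : ℤ) < rowCount v t + 1 := by exact_mod_cast this
  omega

lemma rowCount_le {g : ℕ} {t : ℤ} (h : rightEnd v t - leftEnd v t < g) :
    rowCount v t ≤ g := by
  have h1 := Int.le_ceil (leftEnd v t)
  have h2 := Int.floor_le (rightEnd v t)
  have : (rowCount v t : ℝ) < g + 1 := by rw [rowCount]; push_cast; linarith
  have : rowCount v t < (g : ℤ) + 1 := by exact_mod_cast this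
  omega

namespace IsConvexLatticePolygon

variable (hv : IsConvexLatticePolygon v)
include hv

lemma cross_pos (i : ZMod N) : 0 < cross (v i - v (i - 1)) (v (i + 1) - v i) := by
  have e : i - 1 + 1 = i := sub_add_cancel i 1
  have h := hv.2 (i - 1) (i + 1)
    (by intro h; apply hv.add_two_ne (i - 1); rw [e, h]) (by rw [e]; exact hv.add_one_ne i)
  rw [e] at h
  simp only [cross, Pi.sub_apply] at h ⊢
  linarith

lemma ne_succ (i : ZMod N) : v i ≠ v (i + 1) := by
  intro h
  have := hv.2 i (i + 1 + 1) (hv.add_two_ne i) (hv.add_one_ne _)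
  rw [h] at this
  simp [cross] at this

variable [NeZero N]

lemma leftEnd_lt_rightEnd_of_eq {k : ZMod N} (h : v (k - 1) 1 = v k 1) :
    leftEnd v (v k 1) < rightEnd v (v k 1) := by
  have h1 : (lowest v : ℝ) ≤ v k 1 := by exact_mod_cast lowest_le k
  have h2 : (v k 1 : ℝ) ≤ highest v := by exact_mod_cast le_highest k
  have hm : ∀ j, !₂[(v j 0 : ℝ), (v j 1 : ℝ)] ∈ region v := fun j => by
    have : !₂[(v j 0 : ℝ), (v j 1 : ℝ)] = toPlane (v j) := by apply plane_ext <;> rfl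
    rw [this]
    exact vertex_mem_region j
  have p1 := (hv.mem_region_iff h1 h2).1 (hm k)
  have p2 := (hv.mem_region_iff h1 h2).1 (h ▸ hm (k - 1))
  by_contra! hc
  have : (v k 0 : ℝ) = v (k - 1) 0 := by linarith
  have h0 : v k 0 = v (k - 1) 0 := by exact_mod_cast this
  apply hv.ne_succ (k - 1)
  rw [sub_add_cancel]
  ext i; fin_cases i
  · exact h0.symm
  · exact h

omit [NeZero N] in
/-- Every vertex is an end of the slice at its height. -/
lemma vertex_eq_rightEnd_or_leftEnd (k : ZMod N) :
    (v k 0 : ℝ) = rightEnd v (v k 1) ∨ (v k 0 : ℝ) = leftEnd v (v k 1) := by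
  rcases lt_trichotomy (v k 1) (v (k + 1) 1) with h | h | h
  · left; rw [hv.rightEnd_eq h le_rfl (by exact_mod_cast h.le), edgeX_left]
  · have e : k - 1 + 1 = k := sub_add_cancel k 1
    have hne : v (k - 1) 1 ≠ v k 1 := by
      intro h'
      have := hv.cross_pos k
      simp [cross, h', h] at this
    rcases hne.lt_or_gt with h' | h'
    · left
      have h'' : v (k - 1) 1 < v (k - 1 + 1) 1 := by rwa [e]
      have := hv.rightEnd_eq h'' (t := v k 1) (by exact_mod_cast h'.le) (by rw [e])
      have h3 := edgeX_right _ h''.ne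
      rw [e] at h3
      rw [this, h3]
    · right
      have h'' : v (k - 1 + 1) 1 < v (k - 1) 1 := by rwa [e]
      have := hv.leftEnd_eq h'' (t := v k 1) (by rw [e]) (by exact_mod_cast h'.le)
      have h3 := edgeX_right _ h''.ne'
      rw [e] at h3
      rw [this, h3]
  · right; rw [hv.leftEnd_eq h (by exact_mod_cast h.le) le_rfl, edgeX_left]

omit hv [NeZero N] in
lemma lt_abs_sub_of_mem_facet {g : ℕ} (hg : 0 < g) (hb : ShortBond v ![(g : ℤ), 0]) {j k : ZMod N}
    (hj : v j 1 ≠ v (j + 1) 1) {s : ℝ} (hs : !₂[s, (v k 1 : ℝ)] ∈ facet v j) (hne : s ≠ v k 0) :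
    (g : ℝ) < |s - v k 0| := by
  have hgR : (0 : ℝ) < g := by exact_mod_cast hg
  have hk : toPlane (v k) ∉ facet v j := by
    intro hk
    have h1 := side_eq_zero_of_mem_facet hk
    have h2 := side_eq_zero_of_mem_facet hs
    simp only [side, toPlane_apply, Matrix.cons_val_zero, Matrix.cons_val_one] at h1 h2
    have h3 : ((v (j + 1) 1 : ℝ) - v j 1) * (s - v k 0) = 0 := by linarith
    rcases mul_eq_zero.1 h3 with h | h
    · exact hj (by exact_mod_cast (sub_eq_zero.1 h).symm)
    · exact hne (sub_eq_zero.1 h)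
  have := hb k j ((s - v k 0) / g) hk (by
    convert hs using 1
    apply plane_ext <;> simp
    field_simp; ring)
  rwa [abs_div, abs_of_pos hgR, lt_div_iff₀ hgR, one_mul] at this

/-- The slice through a vertex is a point or longer than the bond. -/
lemma lt_length_vertex {g : ℕ} (hg : 0 < g) (hb : ShortBond v ![(g : ℤ), 0]) (k : ZMod N)
    (hk : leftEnd v (v k 1) < rightEnd v (v k 1)) :
    (g : ℝ) < rightEnd v (v k 1) - leftEnd v (v k 1) := by
  have h1 : (lowest v : ℝ) ≤ v k 1 := by exact_mod_cast lowest_le k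
  have h2 : (v k 1 : ℝ) ≤ highest v := by exact_mod_cast le_highest k
  rcases hv.vertex_eq_rightEnd_or_leftEnd k with h | h
  · obtain ⟨j, hj, hj1, hj2⟩ := hv.exists_down h1 h2
    have hm := edgeX_mem_segment' hj1 hj2 hj
    rw [← hv.leftEnd_eq hj hj1 hj2] at hm
    have := lt_abs_sub_of_mem_facet hg hb hj.ne' hm (by rw [h]; exact hk.ne)
    rwa [h, abs_of_neg (by linarith), neg_sub] at this
  · obtain ⟨j, hj, hj1, hj2⟩ := hv.exists_up h1 h2
    have hm := edgeX_mem_segment hj1 hj2 hj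
    rw [← hv.rightEnd_eq hj hj1 hj2] at hm
    have := lt_abs_sub_of_mem_facet hg hb hj.ne hm (by rw [h]; exact hk.ne')
    rwa [h, abs_of_pos (by linarith)] at this

omit [NeZero N] in
/-- Below a strict local maximum of the height, and above its two neighbours, the region coincides
with its tangent cone. -/
lemma ends_of_tip {k : ZMod N} (hk : v (k - 1) 1 < v k 1) (hk' : v (k + 1) 1 < v k 1) {t : ℝ}
    (h1 : (v (k - 1) 1 : ℝ) ≤ t) (h2 : (v (k + 1) 1 : ℝ) ≤ t) (h3 : t ≤ v k 1) :
    rightEnd v t = v k 0 - (v k 1 - t) * ((v k - v (k - 1)) 0 / (v k - v (k - 1)) 1) ∧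
    leftEnd v t = v k 0 - (v k 1 - t) * ((v (k + 1) - v k) 0 / (v (k + 1) - v k) 1) := by
  have e : k - 1 + 1 = k := sub_add_cancel k 1
  have h' : (v (k - 1) 1 : ℝ) < v k 1 := by exact_mod_cast hk
  have h'' : (v k 1 : ℝ) - v (k - 1) 1 ≠ 0 := by linarith
  constructor
  · rw [hv.rightEnd_eq (by rwa [e]) h1 (by rwa [e]), edgeX, e]
    simp only [Pi.sub_apply]
    push_cast
    field_simp
    ring
  · rw [hv.leftEnd_eq hk' h2 h3, edgeX]
    simp only [Pi.sub_apply]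
    push_cast
    ring

omit [NeZero N] in
lemma slope_lt_slope {k : ZMod N} (hk : v (k - 1) 1 < v k 1) (hk' : v (k + 1) 1 < v k 1) :
    ((v k - v (k - 1)) 0 : ℝ) / (v k - v (k - 1)) 1 < (v (k + 1) - v k) 0 / (v (k + 1) - v k) 1 := by
  have h := hv.cross_pos k
  rw [cross] at h
  have h1 : (0 : ℝ) < ((v k - v (k - 1)) 1 : ℤ) := by
    rw [Pi.sub_apply]; exact_mod_cast (by omega)
  have h2 : (((v (k + 1) - v k) 1 : ℤ) : ℝ) < 0 := by
    rw [Pi.sub_apply]; exact_mod_cast (by omega)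
  have h' : (0:ℝ) < (v k - v (k - 1)) 0 * (v (k + 1) - v k) 1 -
      (v k - v (k - 1)) 1 * (v (k + 1) - v k) 0 := by exact_mod_cast h
  rw [← neg_div_neg_eq (((v (k + 1) - v k) 0 : ℤ) : ℝ), div_lt_div_iff₀ h1 (by linarith)]
  linarith

lemma eq_highest_of_le {k : ZMod N} (hk : v (k - 1) 1 ≤ v k 1) (hk' : v (k + 1) 1 ≤ v k 1) :
    v k 1 = highest v := by
  obtain ⟨b, hb⟩ := exists_eq_highest v
  have := hv.le_height_of_side_nonneg hk hk' (hv.side_vertex_nonneg _ b)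
    (hv.side_vertex_nonneg _ b)
  rw [toPlane_apply, hb] at this
  exact le_antisymm (le_highest k) (Int.cast_le.1 this)

/-- Some vertex is on a slice longer than the bond. -/
lemma exists_long_slice {g : ℕ} (hg : 0 < g) (hb : ShortBond v ![(g : ℤ), 0]) :
    ∃ k, (g : ℝ) < rightEnd v (v k 1) - leftEnd v (v k 1) := by
  have hlt := hv.lowest_lt_highest
  obtain ⟨k, hk, hk'⟩ := exists_down_strip (v := v) (t := highest v - 1) (by omega) (by omega)
  have ek : v k 1 = highest v := by have := le_highest (v := v) k; omega
  have e : k - 1 + 1 = k := sub_add_cancel k 1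
  rcases (ek ▸ le_highest (k - 1) : v (k - 1) 1 ≤ v k 1).lt_or_eq with h | h
  · have hs := hv.slope_lt_slope h (by omega : v (k + 1) 1 < v k 1)
    have : ∃ m, v (k - 1) 1 ≤ v m 1 ∧ v (k + 1) 1 ≤ v m 1 ∧ v m 1 < v k 1 := by
      rcases le_total (v (k - 1) 1) (v (k + 1) 1) with h' | h'
      · exact ⟨k + 1, h', le_rfl, by omega⟩
      · exact ⟨k - 1, le_rfl, h', h⟩
    obtain ⟨m, h1, h2, h3⟩ := this
    refine ⟨m, hv.lt_length_vertex hg hb m ?_⟩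
    obtain ⟨e1, e2⟩ := hv.ends_of_tip h (by omega : v (k + 1) 1 < v k 1) (t := v m 1)
      (by exact_mod_cast h1) (by exact_mod_cast h2) (by exact_mod_cast h3.le)
    have h3' : (0 : ℝ) < v k 1 - v m 1 := by rw [sub_pos]; exact_mod_cast h3
    rw [e1, e2]
    linarith [mul_lt_mul_of_pos_left hs h3']
  · exact ⟨k, hv.lt_length_vertex hg hb k (hv.leftEnd_lt_rightEnd_of_eq h)⟩

/-- The rows that are too short for the bond, above a sufficiently long row, lie in the tip of the
region at its highest vertex. -/
lemma sum_deficit_top {g : ℕ} (hg : 0 < g) (hb : ShortBond v ![(g : ℤ), 0]) {T : ℤ}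
    (hT : lowest v ≤ T) (hT' : T ≤ highest v) (hlong : (g : ℝ) ≤ rightEnd v T - leftEnd v T) :
    ∑ t ∈ Finset.Ioc T (highest v), max ((g : ℝ) - rowCount v t) 0 =
      ∑ i, if v (i - 1) 1 < v i 1 ∧ v (i + 1) 1 < v i 1 then (g : ℝ) - 1 + tipSum v g i else 0 := by
  have hlt := hv.lowest_lt_highest
  obtain ⟨k, hk, hk'⟩ := exists_down_strip (v := v) (t := highest v - 1) (by omega) (by omega)
  have ek : v k 1 = highest v := by have := le_highest (v := v) k; omega
  have huniq : ∀ i, i ≠ k → ¬ (v (i - 1) 1 < v i 1 ∧ v (i + 1) 1 < v i 1) := by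
    rintro i hik ⟨h1, h2⟩
    have := hv.eq_highest_of_le h1.le h2.le
    exact hik (hv.down_unique (t := highest v - 1) (by omega) (by omega) hk hk')
  rw [Finset.sum_eq_single k (fun i _ hi => if_neg (huniq i hi)) (by simp)]
  have hTR : (lowest v : ℝ) ≤ T := by exact_mod_cast hT
  have hzero : ∀ t : ℤ, (g : ℝ) ≤ rightEnd v t - leftEnd v t →
      max ((g : ℝ) - rowCount v t) 0 = 0 := by
    intro t ht
    have : (g : ℝ) ≤ rowCount v t := by exact_mod_cast le_rowCount ht
    exact max_eq_right (by linarith)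
  -- the highest slice is either a vertex or a horizontal facet; in the second case concavity of the
  -- slice length leaves no short row
  rcases (ek ▸ le_highest (k - 1) : v (k - 1) 1 ≤ v k 1).lt_or_eq with h | h
  · have hk1 : v (k + 1) 1 < v k 1 := by omega
    rw [if_pos ⟨h, hk1⟩]
    have hs := hv.slope_lt_slope h hk1
    have htip := fun (t : ℝ) => hv.ends_of_tip h hk1 (t := t)
    have hC : (0 : ℝ) < cross (v k - v (k - 1)) (v (k + 1) - v k) := by
      exact_mod_cast hv.cross_pos k
    have hgR : (1 : ℝ) ≤ g := by exact_mod_cast hg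
    rw [tipSum]
    set C : ℝ := ((cross (v k - v (k - 1)) (v (k + 1) - v k) : ℤ) : ℝ) with hCdef
    have hCeq : C = (v k - v (k - 1)) 0 * (v (k + 1) - v k) 1 -
      (v k - v (k - 1)) 1 * (v (k + 1) - v k) 0 := by rw [hCdef, cross]; push_cast; rfl
    have ha1 : (0 : ℝ) < ((v k - v (k - 1)) 1 : ℤ) := by
      rw [Pi.sub_apply]; exact_mod_cast (by omega)
    have hb1 : (((v (k + 1) - v k) 1 : ℤ) : ℝ) < 0 := by
      rw [Pi.sub_apply]; exact_mod_cast (by omega)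
    generalize (((v k - v (k - 1)) 0 : ℤ) : ℝ) = a0 at *
    generalize (((v k - v (k - 1)) 1 : ℤ) : ℝ) = a1 at *
    generalize (((v (k + 1) - v k) 0 : ℤ) : ℝ) = b0 at *
    generalize (((v (k + 1) - v k) 1 : ℤ) : ℝ) = b1 at *
    clear_value C
    have hb1' : b1 ≠ 0 := hb1.ne
    -- the depth at which the tangent cone is as wide as the bond is long
    set d : ℝ := g * a1 * -b1 / C with hd
    have hdpos : 0 < d := by
      apply div_pos _ hC
      apply mul_pos (mul_pos (by linarith) ha1) (by linarith)
    have habs : |g * a1 * b1 / C| = d := by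
      rw [hd, mul_neg, neg_div, abs_of_neg]
      rw [hd, mul_neg, neg_div] at hdpos
      linarith
    have hdk : d * (b0 / b1 - a0 / a1) = g := by
      rw [hd]; field_simp; rw [hCeq]; ring
    have hne : g * a1 * b1 / C ≠ 0 := by
      rw [← abs_pos, habs]; exact hdpos
    have hr1 : (-(g * a1 * b0 / C) - ((g : ℤ) : ℝ)) / d = a0 / a1 := by
      rw [hd]; field_simp; rw [hCeq]; push_cast; ring
    have hr2 : (-(g * a1 * b0 / C)) / d = b0 / b1 := by
      rw [hd]; field_simp
    rw [triangleSum, if_neg hne, habs, hr1, hr2]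
    have hslope : 0 < b0 / b1 - a0 / a1 := by linarith
    generalize b0 / b1 = q at *
    generalize a0 / a1 = p at *
    have hlen : ∀ t : ℝ, (v (k - 1) 1 : ℝ) ≤ t → (v (k + 1) 1 : ℝ) ≤ t → t ≤ v k 1 →
        rightEnd v t - leftEnd v t = (v k 1 - t) * (q - p) := by
      intro t h1 h2 h3
      rw [(htip t h1 h2 h3).1, (htip t h1 h2 h3).2]; ring
    obtain ⟨m, hm1, hm2, hm3⟩ : ∃ m, v (k - 1) 1 ≤ v m 1 ∧ v (k + 1) 1 ≤ v m 1 ∧ v m 1 < v k 1 := by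
      rcases le_total (v (k - 1) 1) (v (k + 1) 1) with h' | h'
      · exact ⟨k + 1, h', le_rfl, by omega⟩
      · exact ⟨k - 1, le_rfl, h', h⟩
    have hm1' : (v (k - 1) 1 : ℝ) ≤ v m 1 := by exact_mod_cast hm1
    have hm2' : (v (k + 1) 1 : ℝ) ≤ v m 1 := by exact_mod_cast hm2
    have hm3' : (v m 1 : ℝ) < v k 1 := by exact_mod_cast hm3
    have hmlen := hlen _ hm1' hm2' hm3'.le
    have hmlong := hv.lt_length_vertex hg hb m (by
      have : 0 < ((v k 1 : ℝ) - v m 1) * (q - p) := mul_pos (by linarith) hslope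
      linarith)
    have hmd : (v m 1 : ℝ) < v k 1 - d := by
      rw [hmlen, ← hdk] at hmlong
      have := lt_of_mul_lt_mul_right hmlong hslope.le
      linarith
    -- hence both neighbours of the vertex lie below depth `d`, and so does the long row at `T`
    have hTd : (T : ℝ) ≤ v k 1 - d := by
      by_contra! hc
      have := hlen T (by linarith) (by linarith) (by rw [ek]; exact_mod_cast hT')
      rw [this, ← hdk] at hlong
      have := le_of_mul_le_mul_right hlong hslope
      linarith
    have hceil : ⌈d⌉ ≤ v k 1 - T := by
      rw [Int.ceil_le]; push_cast; linarith
    have hceil0 : 0 < ⌈d⌉ := Int.ceil_pos.2 hdpos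
    rw [← ek, ← Finset.sum_subset (s₁ := Finset.Ioc (v k 1 - ⌈d⌉) (v k 1))
      (Finset.Ioc_subset_Ioc_left (by omega))]
    · have hrow : ∀ j ∈ Finset.Ico 0 ⌈d⌉, max ((g : ℝ) - rowCount v (v k 1 - j)) 0 =
          (((g : ℤ) - 1 + (⌈p * (j : ℝ)⌉ - ⌊q * (j : ℝ)⌋) : ℤ) : ℝ) := by
        intro j hj
        rw [Finset.mem_Ico] at hj
        have hj0 : (0 : ℝ) ≤ j := by exact_mod_cast hj.1
        have hjd : (j : ℝ) < d := Int.lt_ceil.1 hj.2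
        have e1 : ((v k 1 - j : ℤ) : ℝ) = v k 1 - j := by push_cast; rfl
        have hle := rowCount_le (v := v) (g := g) (t := v k 1 - j) (by
          rw [e1, hlen _ (by linarith) (by linarith) (by linarith), ← hdk]
          rw [sub_sub_cancel]
          exact mul_lt_mul_of_pos_right hjd hslope)
        have hle' : (rowCount v (v k 1 - j) : ℝ) ≤ g := by exact_mod_cast hle
        rw [max_eq_left (by linarith), rowCount, e1,
          (htip _ (by linarith) (by linarith) (by linarith)).1,
          (htip _ (by linarith) (by linarith) (by linarith)).2, sub_sub_cancel,
          sub_eq_add_neg (v k 0 : ℝ), sub_eq_add_neg (v k 0 : ℝ), Int.floor_intCast_add, Int.ceil_intCast_add,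
          Int.floor_neg, Int.ceil_neg, mul_comm p, mul_comm q]
        push_cast
        ring
      have hre : ∑ t ∈ Finset.Ioc (v k 1 - ⌈d⌉) (v k 1), max ((g : ℝ) - rowCount v t) 0 =
          ∑ j ∈ Finset.Ico 0 ⌈d⌉, max ((g : ℝ) - rowCount v (v k 1 - j)) 0 := by
        refine Finset.sum_bij' (fun t _ => v k 1 - t) (fun j _ => v k 1 - j) ?_ ?_ ?_ ?_ ?_
        · intro t; rw [Finset.mem_Ioc, Finset.mem_Ico]; omega
        · intro t; rw [Finset.mem_Ioc, Finset.mem_Ico]; omega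
        · intro t _; ring
        · intro t _; ring
        · intro t _; rw [sub_sub_cancel]
      rw [hre, Finset.sum_congr rfl hrow, ← Int.cast_sum]
      have hI : Finset.Ico 0 ⌈d⌉ = insert 0 (Finset.Icc 1 (⌈d⌉ - 1)) := by
        ext j; rw [Finset.mem_insert, Finset.mem_Ico, Finset.mem_Icc]; omega
      rw [hI, Finset.sum_insert (by simp), Finset.sum_add_distrib, Finset.sum_const, Int.card_Icc,
        nsmul_eq_mul, Int.toNat_of_nonneg (by omega)]
      push_cast
      simp
    · intro t ht ht'
      rw [Finset.mem_Ioc] at ht ht'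
      apply hzero
      have h1 : (t : ℝ) ≤ v k 1 - d := by
        have : ⌈d⌉ ≤ v k 1 - t := by omega
        rw [Int.ceil_le] at this
        push_cast at this
        linarith
      refine hv.le_length_of_le_of_le hTR ?_ (by exact_mod_cast ht.1.le) h1 hlong ?_
      · rw [← ek]; linarith
      · rw [hlen _ (by linarith) (by linarith) (by linarith), sub_sub_cancel, hdk]
  · rw [if_neg (by omega)]
    have hlong' := hv.lt_length_vertex hg hb k (hv.leftEnd_lt_rightEnd_of_eq h)
    rw [ek] at hlong'
    refine Finset.sum_eq_zero fun t ht => hzero t ?_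
    rw [Finset.mem_Ioc] at ht
    exact hv.le_length_of_le_of_le hTR le_rfl (by exact_mod_cast ht.1.le) (by exact_mod_cast ht.2)
      hlong hlong'.le

lemma sum_deficit_bottom {g : ℕ} (hg : 0 < g) (hb : ShortBond v ![(g : ℤ), 0]) {T : ℤ}
    (hT : lowest v ≤ T) (hT' : T ≤ highest v) (hlong : (g : ℝ) ≤ rightEnd v T - leftEnd v T) :
    ∑ t ∈ Finset.Ico (lowest v) T, max ((g : ℝ) - rowCount v t) 0 =
      ∑ i, if v i 1 < v (i - 1) 1 ∧ v i 1 < v (i + 1) 1 then (g : ℝ) - 1 + tipSum v g i else 0 := by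
  have := hv.neg.sum_deficit_top hg hb.neg (T := -T) (by rw [lowest_neg]; omega)
    (by rw [highest_neg]; omega)
    (by push_cast; rw [leftEnd_neg, rightEnd_neg]; linarith)
  simp only [Pi.neg_apply, neg_lt_neg_iff, tipSum_neg] at this
  rw [← this]
  refine Finset.sum_bij' (fun t _ => -t) (fun j _ => -j) ?_ ?_ ?_ ?_ ?_
  · intro t; rw [Finset.mem_Ioc, Finset.mem_Ico, highest_neg]; omega
  · intro t; rw [Finset.mem_Ioc, Finset.mem_Ico, highest_neg]; omega
  · intro t _; ring
  · intro t _; ring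
  · intro t _; rw [rowCount_neg]

/-- The numbers by which rows are shorter than the bond add up to a sum over the vertices at
which a horizontal line touches the region in that vertex only. -/
lemma sum_deficit {g : ℕ} (hg : 0 < g) (hb : ShortBond v ![(g : ℤ), 0]) :
    ∑ t ∈ Finset.Icc (lowest v) (highest v), max ((g : ℝ) - rowCount v t) 0 =
      ∑ i, if (v i - v (i - 1)) 1 * (v (i + 1) - v i) 1 < 0 then (g : ℝ) - 1 + tipSum v g i
        else 0 := by
  -- a row that is long enough separates the upper short rows from the lower ones
  obtain ⟨k, hk⟩ := hv.exists_long_slice hg hb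
  have h1 := lowest_le (v := v) k
  have h2 := le_highest (v := v) k
  have ht := hv.sum_deficit_top hg hb h1 h2 hk.le
  have hbot := hv.sum_deficit_bottom hg hb h1 h2 hk.le
  have hsplit : Finset.Icc (lowest v) (highest v) =
      insert (v k 1) (Finset.Ico (lowest v) (v k 1) ∪ Finset.Ioc (v k 1) (highest v)) := by
    ext t
    rw [Finset.mem_insert, Finset.mem_union, Finset.mem_Icc, Finset.mem_Ico, Finset.mem_Ioc]
    omega
  have hrow : (g : ℝ) ≤ rowCount v (v k 1) := by exact_mod_cast le_rowCount hk.le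
  rw [hsplit, Finset.sum_insert (by simp), max_eq_right (by linarith), zero_add,
    Finset.sum_union, ht, hbot, ← Finset.sum_add_distrib]
  · refine Finset.sum_congr rfl fun i _ => ?_
    have hiff : (v i - v (i - 1)) 1 * (v (i + 1) - v i) 1 < 0 ↔
        (v i 1 < v (i - 1) 1 ∧ v i 1 < v (i + 1) 1) ∨ (v (i - 1) 1 < v i 1 ∧ v (i + 1) 1 < v i 1) := by
      rw [mul_neg_iff, Pi.sub_apply, Pi.sub_apply]
      omega
    by_cases c1 : v i 1 < v (i - 1) 1 ∧ v i 1 < v (i + 1) 1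
    · rw [if_pos c1, if_neg (by omega), if_pos (hiff.2 (Or.inl c1)), add_zero]
    by_cases c2 : v (i - 1) 1 < v i 1 ∧ v (i + 1) 1 < v i 1
    · rw [if_neg c1, if_pos c2, if_pos (hiff.2 (Or.inr c2)), zero_add]
    · rw [if_neg c1, if_neg c2, if_neg (by rw [hiff]; exact not_or.2 ⟨c1, c2⟩), add_zero]
  · rw [Finset.disjoint_left]
    intro t; rw [Finset.mem_Ico, Finset.mem_Ioc]; omega

end IsConvexLatticePolygon

/-! ### Area and boundary -/

/-- The area of a planar set is the integral of the lengths of its horizontal slices. -/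
lemma volume_eq_lintegral_slice {s : Set Plane} (hs : MeasurableSet s) :
    volume s = ∫⁻ t : ℝ, volume {x : ℝ | !₂[x, t] ∈ s} := by
  let e : ℝ × ℝ ≃ᵐ Plane := (MeasurableEquiv.finTwoArrow (α := ℝ)).symm.trans
    (MeasurableEquiv.toLp 2 (Fin 2 → ℝ))
  have he : MeasurePreserving e := by
    refine MeasurePreserving.trans ((volume_preserving_finTwoArrow ℝ).symm _) ?_
    exact PiLp.volume_preserving_toLp (Fin 2)
  have happ : ∀ p : ℝ × ℝ, e p = !₂[p.1, p.2] := fun p => rfl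
  rw [← he.measure_preimage hs.nullMeasurableSet, Measure.volume_eq_prod,
    Measure.prod_apply_symm (e.measurable hs)]
  rfl

lemma measurableSet_region [NeZero N] : MeasurableSet (region v) :=
  isCompact_region.isClosed.measurableSet

lemma integral_affine (A B n : ℝ) : ∫ t in n..(n + 1), (A + (t - n) * (B - A)) = (A + B) / 2 := by
  have h : ∫ t in n..(n + 1), (A + (t - n) * (B - A)) = ∫ t in (0 : ℝ)..1, (A + t * (B - A)) := by
    rw [intervalIntegral.integral_comp_sub_right (fun t => A + t * (B - A))]
    simp
  rw [h, intervalIntegral.integral_add (by simp)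
    (Continuous.intervalIntegrable (by fun_prop) _ _),
    intervalIntegral.integral_mul_const, integral_id]
  simp; ring

lemma edgeX_affine (i : ZMod N) (n t : ℝ) :
    edgeX v i t = edgeX v i n + (t - n) * (edgeX v i (n + 1) - edgeX v i n) := by
  simp only [edgeX]; ring

/-- A finite intersection of nondegenerate closed half-spaces has the corresponding intersection of
open half-spaces as its interior. -/
lemma interior_setOf_forall_nonneg {ι : Type*} [Finite ι] (f : ι → Plane → ℝ)
    (hc : ∀ i, Continuous (f i)) (d : ι → Plane)
    (hd : ∀ i p, ∀ ε > (0 : ℝ), f i (p + ε • d i) < f i p) :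
    interior {p | ∀ i, 0 ≤ f i p} = {p | ∀ i, 0 < f i p} := by
  apply Set.Subset.antisymm
  · intro p hp i
    have hcont : Filter.Tendsto (fun ε : ℝ => p + ε • d i) (nhdsWithin 0 (Set.Ioi 0)) (nhds p) := by
      have : Continuous fun ε : ℝ => p + ε • d i := by fun_prop
      have := this.tendsto 0
      rw [zero_smul, add_zero] at this
      exact this.mono_left nhdsWithin_le_nhds
    have h1 := hcont.eventually (isOpen_interior.mem_nhds hp)
    obtain ⟨ε, hε, hpos⟩ := (h1.and self_mem_nhdsWithin).exists
    exact (interior_subset hε i).trans_lt (hd i p ε hpos)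
  · refine interior_maximal (fun p hp i => (hp i).le) ?_
    have : {p | ∀ i, 0 < f i p} = ⋂ i, {p | 0 < f i p} := by ext; simp
    rw [this]
    exact isOpen_iInter_of_finite fun i => isOpen_lt continuous_const (hc i)

namespace IsConvexLatticePolygon

variable [NeZero N] (hv : IsConvexLatticePolygon v)
include hv

lemma lintegral_strip {n : ℤ} (h1 : lowest v ≤ n) (h2 : n < highest v) :
    ∫⁻ t in Set.Ioc (n : ℝ) (n + 1), volume {x : ℝ | !₂[x, t] ∈ region v} =
      ENNReal.ofReal (((rightEnd v n - leftEnd v n) +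
        (rightEnd v (n + 1) - leftEnd v (n + 1))) / 2) := by
  obtain ⟨i, hi, hi'⟩ := exists_up_strip h1 h2
  obtain ⟨j, hj, hj'⟩ := exists_down_strip h1 h2
  have h1' : (lowest v : ℝ) ≤ n := by exact_mod_cast h1
  have h2' : (n : ℝ) + 1 ≤ highest v := by exact_mod_cast h2
  have ci : (v i 1 : ℝ) ≤ n := by exact_mod_cast hi
  have ci' : (n : ℝ) + 1 ≤ v (i + 1) 1 := by exact_mod_cast hi'
  have cj : (v (j + 1) 1 : ℝ) ≤ n := by exact_mod_cast hj
  have cj' : (n : ℝ) + 1 ≤ v j 1 := by exact_mod_cast hj'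
  have hlen : ∀ t ∈ Set.Icc (n : ℝ) (n + 1), rightEnd v t - leftEnd v t =
      (rightEnd v n - leftEnd v n) + (t - n) * ((rightEnd v (n + 1) - leftEnd v (n + 1)) -
        (rightEnd v n - leftEnd v n)) := by
    rintro t ⟨ht1, ht2⟩
    rw [hv.rightEnd_eq (i := i) (t := t) (by omega) (by linarith) (by linarith),
      hv.rightEnd_eq (i := i) (t := n) (by omega) (by linarith) (by linarith),
      hv.rightEnd_eq (i := i) (t := n + 1) (by omega) (by linarith) (by linarith),
      hv.leftEnd_eq (i := j) (t := t) (by omega) (by linarith) (by linarith),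
      hv.leftEnd_eq (i := j) (t := n) (by omega) (by linarith) (by linarith),
      hv.leftEnd_eq (i := j) (t := n + 1) (by omega) (by linarith) (by linarith),
      edgeX_affine i n t, edgeX_affine j n t]
    ring
  rw [← integral_affine _ _ (n : ℝ), intervalIntegral.integral_of_le (by linarith),
    ofReal_integral_eq_lintegral_ofReal]
  · refine setLIntegral_congr_fun measurableSet_Ioc fun t ht => ?_
    have ht' : t ∈ Set.Icc (n : ℝ) (n + 1) := Set.Ioc_subset_Icc_self ht
    have : {x : ℝ | !₂[x, t] ∈ region v} = Set.Icc (leftEnd v t) (rightEnd v t) := by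
      ext x
      exact hv.mem_region_iff (by linarith [ht'.1]) (by linarith [ht'.2])
    rw [this, Real.volume_Icc, hlen t ht']
  · exact (Continuous.integrableOn_Icc (by fun_prop)).mono_set Set.Ioc_subset_Icc_self
  · refine (ae_restrict_iff' measurableSet_Ioc).2 (Filter.Eventually.of_forall fun t ht => ?_)
    have ht' : t ∈ Set.Icc (n : ℝ) (n + 1) := Set.Ioc_subset_Icc_self ht
    rw [Pi.zero_apply]
    beta_reduce
    rw [← hlen t ht']
    exact sub_nonneg.2 (hv.leftEnd_le_rightEnd (by linarith [ht'.1]) (by linarith [ht'.2]))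

/-- The region is cut by the horizontal lattice lines into trapezoids. -/
lemma two_mul_area : 2 * volume.real (region v) =
    ∑ t ∈ Finset.Ico (lowest v) (highest v), ((rightEnd v t - leftEnd v t) +
        (rightEnd v (t + 1) - leftEnd v (t + 1))) := by
  have hlt := hv.lowest_lt_highest
  have h1 : volume (region v) =
      ∫⁻ t in Set.Ioc (lowest v : ℝ) (highest v), volume {x : ℝ | !₂[x, t] ∈ region v} := by
    rw [volume_eq_lintegral_slice measurableSet_region, setLIntegral_congr Ioc_ae_eq_Icc,
      setLIntegral_eq_of_support_subset]
    intro t ht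
    by_contra hc
    apply ht
    have : {x : ℝ | !₂[x, t] ∈ region v} = ∅ := by
      ext x
      simp only [Set.mem_ofPred_eq, Set.mem_empty_iff_false, iff_false]
      intro hx
      exact hc (by simpa using height_mem hx)
    beta_reduce
    rw [this, measure_empty]
  have h2 : Set.Ioc (lowest v : ℝ) (highest v) =
      ⋃ n ∈ Finset.Ico (lowest v) (highest v), Set.Ioc (n : ℝ) (n + 1) := by
    ext t
    simp only [Set.mem_Ioc, Set.mem_iUnion, Finset.mem_Ico, exists_prop]
    constructor
    · rintro ⟨h3, h4⟩
      refine ⟨⌈t⌉ - 1, ⟨?_, ?_⟩, ?_, ?_⟩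
      · have := Int.lt_ceil.2 h3; omega
      · have := Int.ceil_le.2 h4; omega
      · push_cast; linarith [Int.ceil_lt_add_one t]
      · push_cast; linarith [Int.le_ceil t]
    · rintro ⟨n, ⟨h3, h4⟩, h5, h6⟩
      have h3' : (lowest v : ℝ) ≤ n := by exact_mod_cast h3
      have h4' : (n : ℝ) + 1 ≤ highest v := by exact_mod_cast h4
      exact ⟨by linarith, by linarith⟩
  have hpos : ∀ t ∈ Finset.Ico (lowest v) (highest v),
      0 ≤ ((rightEnd v t - leftEnd v t) + (rightEnd v (t + 1) - leftEnd v (t + 1))) / 2 := by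
    intro t ht
    rw [Finset.mem_Ico] at ht
    have h3' : (lowest v : ℝ) ≤ t := by exact_mod_cast ht.1
    have h4' : (t : ℝ) + 1 ≤ highest v := by exact_mod_cast ht.2
    have e1 := hv.leftEnd_le_rightEnd h3' (by linarith)
    have e2 := hv.leftEnd_le_rightEnd (by linarith) h4'
    linarith
  rw [measureReal_def, h1, h2, lintegral_biUnion_finset]
  · rw [Finset.sum_congr rfl fun n hn => hv.lintegral_strip (Finset.mem_Ico.1 hn).1
      (Finset.mem_Ico.1 hn).2, ← ENNReal.ofReal_sum_of_nonneg hpos,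
      ENNReal.toReal_ofReal (Finset.sum_nonneg hpos), ← Finset.sum_div]
    ring
  · intro m _ n _ hmn
    rw [Function.onFun, Set.disjoint_left]
    rintro t ⟨h3, h4⟩ ⟨h5, h6⟩
    have h7 : (m : ℝ) < n + 1 := by linarith
    have h8 : (n : ℝ) < m + 1 := by linarith
    apply hmn
    have h7' : m < n + 1 := by exact_mod_cast h7
    have h8' : n < m + 1 := by exact_mod_cast h8
    omega
  · exact fun _ _ => measurableSet_Ioc

/-- A convex lattice polygon is the intersection of the half-planes of its facets. -/
lemma region_eq : region v = {p | ∀ i, 0 ≤ side v i p} := by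
  apply Set.Subset.antisymm
  · exact fun p hp i => hv.side_nonneg hp i
  · intro p hp
    have hneg : ∀ i, side (-v) i (-p) = side v i p := by
      intro i; simp only [side, Pi.neg_apply, PiLp.neg_apply]; push_cast; ring
    have htop : p 1 ≤ highest v := by
      obtain ⟨b, hb⟩ := exists_eq_highest v
      rw [← hb]
      exact hv.le_height_of_side_nonneg (by rw [hb]; exact le_highest _)
        (by rw [hb]; exact le_highest _) (hp _) (hp _)
    have hbot : (lowest v : ℝ) ≤ p 1 := by
      obtain ⟨b, hb⟩ := exists_eq_lowest v
      rw [← hb]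
      have := hv.neg.le_height_of_side_nonneg (i := b) (p := -p)
        (by simp only [Pi.neg_apply, neg_le_neg_iff]; rw [hb]; exact lowest_le _)
        (by simp only [Pi.neg_apply, neg_le_neg_iff]; rw [hb]; exact lowest_le _)
        (by rw [hneg]; exact hp _) (by rw [hneg]; exact hp _)
      simpa using this
    obtain ⟨i, hi, hi1, hi2⟩ := hv.exists_up hbot htop
    obtain ⟨j, hj, hj1, hj2⟩ := hv.exists_down hbot htop
    have e : p = !₂[p 0, p 1] := by apply plane_ext <;> rfl
    rw [e, hv.mem_region_iff hbot htop, hv.rightEnd_eq hi hi1 hi2, hv.leftEnd_eq hj hj1 hj2]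
    have hi' : (0 : ℝ) < v (i + 1) 1 - v i 1 := by rw [sub_pos]; exact_mod_cast hi
    have hj' : (0 : ℝ) < v j 1 - v (j + 1) 1 := by rw [sub_pos]; exact_mod_cast hj
    have si := hp i
    have sj := hp j
    rw [side] at si sj
    constructor
    · rw [edgeX, ← le_sub_iff_add_le', ← neg_div_neg_eq, mul_div_assoc', neg_sub, neg_sub,
        div_le_iff₀ hj']
      linarith
    · rw [edgeX, ← sub_le_iff_le_add', mul_div_assoc', le_div_iff₀ hi']
      linarith

lemma interior_region : interior (region v) = {p | ∀ i, 0 < side v i p} := by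
  rw [hv.region_eq]
  refine interior_setOf_forall_nonneg _ continuous_side
    (fun i => !₂[(v (i + 1) 1 : ℝ) - v i 1, -((v (i + 1) 0 : ℝ) - v i 0)]) ?_
  intro i p ε hε
  have h := hv.ne_succ i
  have hpos : 0 < ((v (i + 1) 0 : ℝ) - v i 0) ^ 2 + ((v (i + 1) 1 : ℝ) - v i 1) ^ 2 := by
    by_contra! hc
    have s0 := sq_nonneg ((v (i + 1) 0 : ℝ) - v i 0)
    have s1 := sq_nonneg ((v (i + 1) 1 : ℝ) - v i 1)
    have h0 : ((v (i + 1) 0 : ℝ) - v i 0) ^ 2 = 0 := by linarith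
    have h1 : ((v (i + 1) 1 : ℝ) - v i 1) ^ 2 = 0 := by linarith
    apply h
    ext k; fin_cases k
    · exact_mod_cast (sub_eq_zero.1 (pow_eq_zero_iff (by norm_num) |>.1 h0)).symm
    · exact_mod_cast (sub_eq_zero.1 (pow_eq_zero_iff (by norm_num) |>.1 h1)).symm
  simp only [side, PiLp.add_apply, PiLp.smul_apply, Matrix.cons_val_zero, Matrix.cons_val_one,
    smul_eq_mul]
  nlinarith [mul_pos hε hpos]

lemma frontier_region : frontier (region v) = ⋃ i, facet v i := by
  rw [isCompact_region.isClosed.frontier_eq, hv.interior_region]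
  ext p
  simp only [Set.mem_sdiff, Set.mem_ofPred_eq, Set.mem_iUnion, not_forall, not_lt]
  constructor
  · rintro ⟨hp, i, hi⟩
    exact ⟨i, (hv.side_pos_or_mem_facet hp i).resolve_left hi.not_gt⟩
  · rintro ⟨i, hi⟩
    exact ⟨facet_subset_region i hi, i, (side_eq_zero_of_mem_facet hi).le⟩

/-- The boundary integral of a function that is constant on each facet. -/
lemma integral_frontier (f : Plane → ℝ) (c : ZMod N → ℝ)
    (hf : ∀ i, ∀ x ∈ openSegment ℝ (toPlane (v i)) (toPlane (v (i + 1))), f x = c i) :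
    ∫ x in frontier (region v), f x ∂(Measure.hausdorffMeasure 1 : Measure Plane) =
      ∑ i, dist (toPlane (v i)) (toPlane (v (i + 1))) * c i := by
  have : NullSingletonClass (Measure.hausdorffMeasure 1 : Measure Plane) :=
    Measure.nullSingletonClass_hausdorff Plane one_pos
  set V : Set Plane := Set.range fun i => toPlane (v i) with hV
  have hVfin : V.Finite := Set.finite_range _
  have hV0 : (Measure.hausdorffMeasure 1 : Measure Plane) V = 0 := hVfin.measure_zero _
  have hsub : ∀ i, facet v i \ V ⊆ openSegment ℝ (toPlane (v i)) (toPlane (v (i + 1))) := by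
    rintro i p ⟨h1, h2⟩
    rw [facet, ← insert_endpoints_openSegment] at h1
    rcases h1 with rfl | rfl | h1
    · exact absurd ⟨i, rfl⟩ h2
    · exact absurd ⟨i + 1, rfl⟩ h2
    · exact h1
  have hmeas : ∀ i, MeasurableSet (facet v i \ V) := by
    intro i
    refine MeasurableSet.diff ?_ hVfin.measurableSet
    rw [facet, ← convexHull_pair]
    exact (Set.toFinite _).isCompact_convexHull _ |>.isClosed.measurableSet
  have hmu : ∀ i, (Measure.hausdorffMeasure 1 : Measure Plane) (facet v i \ V) =
      edist (toPlane (v i)) (toPlane (v (i + 1))) := by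
    intro i
    rw [measure_sdiff_null hV0, facet, hausdorffMeasure_segment]
  have h1 : ∫ x in frontier (region v), f x ∂(Measure.hausdorffMeasure 1 : Measure Plane) =
      ∫ x in ⋃ i, facet v i \ V, f x ∂(Measure.hausdorffMeasure 1 : Measure Plane) := by
    rw [hv.frontier_region, ← Set.iUnion_sdiff]
    exact setIntegral_congr_set (sdiff_null_ae_eq_self hV0).symm
  rw [h1, integral_iUnion_fintype hmeas]
  · refine Finset.sum_congr rfl fun i _ => ?_
    rw [setIntegral_congr_fun (hmeas i) fun x hx => hf i x (hsub i hx), setIntegral_const,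
      measureReal_def, hmu, smul_eq_mul, edist_dist, ENNReal.toReal_ofReal dist_nonneg]
  · intro i j hij
    rw [Function.onFun, Set.disjoint_left]
    intro p hi hj
    exact hij (hv.eq_of_mem_openSegment hi.1 (hsub j hj))
  · intro i
    refine (integrableOn_const (C := c i) ?_).congr_fun (fun x hx => (hf i x (hsub i hx)).symm)
      (hmeas i)
    rw [hmu]
    exact edist_ne_top _ _

end IsConvexLatticePolygon

/-! ### Exterior angles -/

lemma pos_and_lt_pi_of_sin_pos {θ : ℝ} (h1 : -Real.pi ≤ θ) (h2 : θ < 2 * Real.pi)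
    (h : 0 < Real.sin θ) : 0 < θ ∧ θ < Real.pi := by
  constructor
  · by_contra! hc
    have := Real.sin_nonpos_of_nonpos_of_neg_pi_le hc h1
    linarith
  · by_contra! hc
    have h3 : Real.sin (θ - Real.pi) = -Real.sin θ := Real.sin_sub_pi θ
    have := Real.sin_nonneg_of_nonneg_of_le_pi (x := θ - Real.pi) (by linarith) (by linarith)
    linarith

/-- The angle by which one turns left from `a` to `b`, in terms of the principal arguments: these
jump by `2π` when the turn crosses the negative real axis. -/
lemma angle_eq_arg_sub_arg {a b : ℂ} (h : 0 < a.re * b.im - a.im * b.re) :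
    InnerProductGeometry.angle a b =
      b.arg - a.arg + if 0 ≤ a.im ∧ b.im < 0 then 2 * Real.pi else 0 := by
  have ha : a ≠ 0 := by rintro rfl; simp at h
  have hb : b ≠ 0 := by rintro rfl; simp at h
  have hna := norm_pos_iff.2 ha
  have hnb := norm_pos_iff.2 hb
  set θ := b.arg - a.arg + if 0 ≤ a.im ∧ b.im < 0 then 2 * Real.pi else 0 with hθ
  have hsin : Real.sin θ = (a.re * b.im - a.im * b.re) / (‖a‖ * ‖b‖) := by
    have : Real.sin θ = Real.sin (b.arg - a.arg) := by
      rw [hθ]; split_ifs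
      · exact Real.sin_add_two_pi _
      · rw [add_zero]
    rw [this, Real.sin_sub, Complex.sin_arg, Complex.sin_arg, Complex.cos_arg ha,
      Complex.cos_arg hb]
    field_simp
  have hcos : Real.cos θ = (a.re * b.re + a.im * b.im) / (‖a‖ * ‖b‖) := by
    have : Real.cos θ = Real.cos (b.arg - a.arg) := by
      rw [hθ]; split_ifs
      · exact Real.cos_add_two_pi _
      · rw [add_zero]
    rw [this, Real.cos_sub, Complex.sin_arg, Complex.sin_arg, Complex.cos_arg ha,
      Complex.cos_arg hb]
    field_simp
  have hsin' : 0 < Real.sin θ := by rw [hsin]; positivity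
  have hrange : -Real.pi ≤ θ ∧ θ < 2 * Real.pi := by
    have a1 := Complex.neg_pi_lt_arg a
    have a2 := Complex.arg_le_pi a
    have b1 := Complex.neg_pi_lt_arg b
    have b2 := Complex.arg_le_pi b
    have hpi := Real.pi_pos
    by_cases h1 : 0 ≤ a.im <;> by_cases h2 : b.im < 0
    · have := Complex.arg_nonneg_iff.2 h1
      have := Complex.arg_neg_iff.2 h2
      rw [hθ, if_pos ⟨h1, h2⟩]
      constructor <;> linarith
    · have := Complex.arg_nonneg_iff.2 h1
      have := Complex.arg_nonneg_iff.2 (not_lt.1 h2)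
      rw [hθ, if_neg (fun h => h2 h.2)]
      constructor <;> linarith
    · have := Complex.arg_neg_iff.2 (not_le.1 h1)
      have := Complex.arg_neg_iff.2 h2
      rw [hθ, if_neg (fun h => h1 h.1)]
      constructor <;> linarith
    · have := Complex.arg_neg_iff.2 (not_le.1 h1)
      have := Complex.arg_nonneg_iff.2 (not_lt.1 h2)
      rw [hθ, if_neg (fun h => h1 h.1)]
      constructor <;> linarith
  obtain ⟨h1, h2⟩ := pos_and_lt_pi_of_sin_pos hrange.1 hrange.2 hsin'
  rw [InnerProductGeometry.angle]
  refine Real.arccos_eq_of_eq_cos h1.le h2.le ?_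
  rw [hcos, Complex.inner]
  simp [mul_comm]

/-- A lattice vector as a complex number. -/
def toComplex (x : LatVec) : ℂ := ⟨x 0, x 1⟩

lemma latGcd_pos {x : LatVec} (hx : x ≠ 0) : 0 < latGcd x := by
  rw [latGcd, Nat.pos_iff_ne_zero, Ne, Int.gcd_eq_zero_iff]
  rintro ⟨h0, h1⟩
  apply hx
  ext k; fin_cases k
  · exact h0
  · exact h1

lemma latGcd_mul_prim (x : LatVec) (k : Fin 2) : (latGcd x : ℤ) * prim x k = x k := by
  rw [prim]
  apply Int.mul_ediv_cancel'
  fin_cases k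
  · exact Int.gcd_dvd_left ..
  · exact Int.gcd_dvd_right ..

lemma prim_ne_zero {x : LatVec} (hx : x ≠ 0) : prim x ≠ 0 := by
  intro h
  apply hx
  ext k
  rw [← latGcd_mul_prim x, h]; simp

lemma norm_toPlane_pos {x : LatVec} (hx : x ≠ 0) : 0 < ‖toPlane x‖ := by
  rw [norm_pos_iff]
  intro h
  apply hx
  ext k
  have : toPlane x k = 0 := by rw [h]; rfl
  rw [toPlane_apply] at this
  exact Int.cast_eq_zero.1 this

lemma latPerp_ne_zero {x : LatVec} (hx : x ≠ 0) : latPerp x ≠ 0 := by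
  intro h
  apply hx
  have h0 := congrFun h 0
  have h1 := congrFun h 1
  simp only [latPerp, Matrix.cons_val_zero, Matrix.cons_val_one, Pi.zero_apply] at h0 h1
  ext k; fin_cases k
  · simpa using h1
  · exact h0

/-- The unit normal of a facet is a positive multiple of the facet vector turned clockwise by a
right angle. -/
lemma exists_unitNormal_eq (hv : IsConvexLatticePolygon v) (i : ZMod N) :
    ∃ c > (0 : ℝ), unitNormal v i = c • perp (toPlane (v (i + 1) - v i)) := by
  have hne : v (i + 1) - v i ≠ 0 := sub_ne_zero.2 (hv.ne_succ i).symm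
  have hg : (0 : ℝ) < latGcd (v (i + 1) - v i) := by exact_mod_cast latGcd_pos hne
  have hnorm := norm_toPlane_pos (latPerp_ne_zero (prim_ne_zero hne))
  refine ⟨‖toPlane (miller v i)‖⁻¹ * (latGcd (v (i + 1) - v i) : ℝ)⁻¹,
    mul_pos (inv_pos.2 hnorm) (inv_pos.2 hg), ?_⟩
  rw [unitNormal, mul_smul]
  congr 1
  rw [eq_inv_smul_iff₀ hg.ne']
  have h := latGcd_mul_prim (v (i + 1) - v i)
  have h0 : (latGcd (v (i + 1) - v i) : ℝ) * prim (v (i + 1) - v i) 0 = (v (i + 1) - v i) 0 := by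
    exact_mod_cast h 0
  have h1 : (latGcd (v (i + 1) - v i) : ℝ) * prim (v (i + 1) - v i) 1 = (v (i + 1) - v i) 1 := by
    exact_mod_cast h 1
  apply plane_ext
  · simp only [PiLp.smul_apply, toPlane_apply, miller, latPerp, perp, Matrix.cons_val_zero,
      smul_eq_mul]
    exact h1
  · simp only [PiLp.smul_apply, toPlane_apply, miller, latPerp, perp, Matrix.cons_val_one,
      smul_eq_mul]
    rw [← h0]; push_cast; ring

lemma perp_toPlane_eq (x : LatVec) :
    perp (toPlane x) = Complex.orthonormalBasisOneI.repr (-Complex.I * toComplex x) := by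
  apply plane_ext <;> simp [perp, toComplex]

lemma angle_perp_toPlane (x y : LatVec) :
    InnerProductGeometry.angle (perp (toPlane x)) (perp (toPlane y)) =
      InnerProductGeometry.angle (toComplex x) (toComplex y) := by
  rw [perp_toPlane_eq, perp_toPlane_eq,
    ← Complex.angle_mul_left (a := -Complex.I) (by simp) (toComplex x)]
  exact Complex.orthonormalBasisOneI.repr.toLinearIsometry.angle_map _ _

/-- The exterior angles of a convex polygon add up to a full turn. -/
lemma IsConvexLatticePolygon.sum_angle [NeZero N] (hv : IsConvexLatticePolygon v) :
    ∑ i, InnerProductGeometry.angle (unitNormal v i) (unitNormal v (i - 1)) = 2 * Real.pi := by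
  have hangle : ∀ i, InnerProductGeometry.angle (unitNormal v i) (unitNormal v (i - 1)) =
      (toComplex (v (i + 1) - v i)).arg - (toComplex (v (i - 1 + 1) - v (i - 1))).arg +
        if v (i - 1) 1 ≤ v i 1 ∧ v (i + 1) 1 < v i 1 then 2 * Real.pi else 0 := by
    intro i
    obtain ⟨c, hc, e1⟩ := exists_unitNormal_eq hv i
    obtain ⟨c', hc', e2⟩ := exists_unitNormal_eq hv (i - 1)
    have e : i - 1 + 1 = i := sub_add_cancel i 1
    have hcr := hv.cross_pos i
    rw [e1, e2, InnerProductGeometry.angle_smul_left_of_pos _ _ hc,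
      InnerProductGeometry.angle_smul_right_of_pos _ _ hc', angle_perp_toPlane,
      InnerProductGeometry.angle_comm, angle_eq_arg_sub_arg, e]
    · congr 1
      simp [toComplex]
    · simp only [toComplex, e]
      rw [cross] at hcr
      exact_mod_cast hcr
  have hlt := hv.lowest_lt_highest
  -- the argument jumps only at the vertex from which the boundary leaves the greatest height
  obtain ⟨k, hk, hk'⟩ := exists_down_strip (v := v) (t := highest v - 1) (by omega) (by omega)
  have ek : v k 1 = highest v := by have := le_highest (v := v) k; omega
  have hshift : ∑ i, (toComplex (v (i - 1 + 1) - v (i - 1))).arg =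
      ∑ i, (toComplex (v (i + 1) - v i)).arg :=
    Equiv.sum_comp (Equiv.subRight (1 : ZMod N)) (fun i => (toComplex (v (i + 1) - v i)).arg)
  rw [Finset.sum_congr rfl fun i _ => hangle i, Finset.sum_add_distrib, Finset.sum_sub_distrib,
    hshift, sub_self, zero_add, Finset.sum_eq_single k]
  · rw [if_pos]
    exact ⟨by rw [ek]; exact le_highest _, by omega⟩
  · intro i _ hik
    refine if_neg ?_
    rintro ⟨h1, h2⟩
    have := hv.eq_highest_of_le h1 h2.le
    exact hik (hv.down_unique (t := highest v - 1) (by omega) (by omega) hk hk')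
  · simp

/-! ### Lattice points in a triangle -/

section Triangle

variable (e u : LatVec)

/-- The coordinates of `p` with respect to a basis `e`, `u` of determinant one. -/
def basisCoord (p : Plane) : Plane := !₂[p 0 * u 1 - p 1 * u 0, e 0 * p 1 - e 1 * p 0]

/-- The coordinates of a lattice vector with respect to a lattice basis `e`, `u` of determinant
one. -/
def latCoord (x : LatVec) : LatVec := ![cross x u, cross e x]

variable {e u}

lemma basisCoord_toPlane (x : LatVec) : basisCoord e u (toPlane x) = toPlane (latCoord e u x) := by
  apply plane_ext <;> simp [basisCoord, latCoord, cross]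

lemma basisCoord_combo (a b : ℝ) (p q : Plane) :
    basisCoord e u (a • p + b • q) = a • basisCoord e u p + b • basisCoord e u q := by
  apply plane_ext <;> simp [basisCoord] <;> ring

lemma eq_of_basisCoord (h : cross e u = 1) (p : Plane) :
    p = basisCoord e u p 0 • toPlane e + basisCoord e u p 1 • toPlane u := by
  have h' : (e 0 : ℝ) * u 1 - e 1 * u 0 = 1 := by rw [cross] at h; exact_mod_cast h
  apply plane_ext <;> simp [basisCoord]
  · linear_combination (-p 0) * h'
  · linear_combination (-p 1) * h'

lemma basisCoord_injective (h : cross e u = 1) : Function.Injective (basisCoord e u) := by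
  intro p q hpq
  rw [eq_of_basisCoord h p, eq_of_basisCoord h q, hpq]

lemma latCoord_injective (h : cross e u = 1) : Function.Injective (latCoord e u) := by
  intro x y hxy
  have h1 : toPlane x = toPlane y := by
    apply basisCoord_injective h
    rw [basisCoord_toPlane, basisCoord_toPlane, hxy]
  ext k
  have : toPlane x k = toPlane y k := by rw [h1]
  exact Int.cast_injective this

lemma latCoord_surjective (h : cross e u = 1) : Function.Surjective (latCoord e u) := by
  intro y
  refine ⟨fun k => y 0 * e k + y 1 * u k, ?_⟩
  rw [cross] at h
  ext k; fin_cases k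
  · simp only [latCoord, cross, Matrix.cons_val_zero, Fin.zero_eta]
    linear_combination y 0 * h
  · change e 0 * (y 0 * e 1 + y 1 * u 1) - e 1 * (y 0 * e 0 + y 1 * u 0) = y 1
    linear_combination y 1 * h

/-- The affine functions that are nonnegative on the triangle which has the vertices `(0, 0)`,
`(g, 0)` and `(β, a)` in the coordinates with respect to `e`, `u`. -/
noncomputable def triangleSide (e u : LatVec) (g β a : ℝ) : Fin 3 → Plane → ℝ :=
  ![fun p => a * basisCoord e u p 1,
    fun p => a ^ 2 * basisCoord e u p 0 - β * (a * basisCoord e u p 1),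
    fun p => a ^ 2 * (g - basisCoord e u p 0) + (β - g) * (a * basisCoord e u p 1)]

lemma convexHull_triangle (h : cross e u = 1) {g β a : ℝ} (hg : 0 < g) (ha : a ≠ 0) {w q : Plane}
    (hw : basisCoord e u w = !₂[g, 0]) (hq : basisCoord e u q = !₂[β, a]) :
    convexHull ℝ {0, w, q} = {p | ∀ i, 0 ≤ triangleSide e u g β a i p} := by
  have ha2 : 0 < a ^ 2 := by positivity
  have h0 : basisCoord e u 0 = 0 := by apply plane_ext <;> simp [basisCoord]
  apply Set.Subset.antisymm
  · refine convexHull_min ?_ ?_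
    · rintro p (rfl | rfl | rfl) i
      · fin_cases i <;> simp [triangleSide, h0]; positivity
      · fin_cases i <;> simp [triangleSide, hw]; positivity
      · fin_cases i <;> simp [triangleSide, hq]
        · exact mul_self_nonneg a
        · apply le_of_eq; ring
        · apply le_of_eq; ring
    · intro x hx y hy b c hb hc hbc i
      have h1 := mul_nonneg hb (hx i)
      have h2 := mul_nonneg hc (hy i)
      obtain rfl : c = 1 - b := by linarith
      have : triangleSide e u g β a i (b • x + (1 - b) • y) =
          b * triangleSide e u g β a i x + (1 - b) * triangleSide e u g β a i y := by
        fin_cases i <;> simp [triangleSide, basisCoord_combo] <;> ring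
      rw [this]
      linarith
  · intro p hp
    have hp0 := hp 0
    have hp1 := hp 1
    have hp2 := hp 2
    simp only [triangleSide, Matrix.cons_val_zero, Matrix.cons_val_one, Matrix.cons_val] at hp0 hp1 hp2
    set s := basisCoord e u p 0 with hs
    set t := basisCoord e u p 1 with ht
    have hmem := (convex_convexHull ℝ ({0, w, q} : Set Plane)).sum_mem (t := Finset.univ)
      (w := ![(a ^ 2 * (g - s) + (β - g) * (a * t)) / (g * a ^ 2), (a ^ 2 * s - β * (a * t)) / (g * a ^ 2),
        a * t / a ^ 2]) (z := ![0, w, q])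
      (by
        intro i _
        fin_cases i
        · exact div_nonneg hp2 (by positivity)
        · exact div_nonneg hp1 (by positivity)
        · exact div_nonneg hp0 (by positivity))
      (by simp [Fin.sum_univ_three]; field_simp; ring)
      (by
        intro i _
        apply subset_convexHull
        fin_cases i <;> simp)
    convert hmem using 1
    apply basisCoord_injective h
    simp only [Fin.sum_univ_three, Matrix.cons_val_zero, Matrix.cons_val_one, Matrix.cons_val,
      smul_zero, zero_add]
    rw [basisCoord_combo, hw, hq]
    apply plane_ext
    · simp [← hs]; field_simp; ring
    · simp [← ht]; field_simp

lemma continuous_triangleSide (g β a : ℝ) (i : Fin 3) : Continuous (triangleSide e u g β a i) := by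
  fin_cases i <;> simp [triangleSide, basisCoord] <;> fun_prop

lemma interior_triangle (h : cross e u = 1) {g β a : ℝ} (hg : 0 < g) (ha : a ≠ 0) {w q : Plane}
    (hw : basisCoord e u w = !₂[g, 0]) (hq : basisCoord e u q = !₂[β, a]) :
    interior (convexHull ℝ {0, w, q}) = {p | ∀ i, 0 < triangleSide e u g β a i p} := by
  rw [convexHull_triangle h hg ha hw hq]
  have ha2 : 0 < a ^ 2 := by positivity
  have hu : basisCoord e u (toPlane u) = !₂[0, 1] := by
    rw [basisCoord_toPlane]
    apply plane_ext
    · simp [latCoord, cross]; ring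
    · simp [latCoord, h]
  have he : basisCoord e u (toPlane e) = !₂[1, 0] := by
    rw [basisCoord_toPlane]
    apply plane_ext
    · simp [latCoord, h]
    · simp [latCoord, cross]; ring
  refine interior_setOf_forall_nonneg _ (continuous_triangleSide g β a)
    ![(-a) • toPlane u, (-1 : ℝ) • toPlane e, (1 : ℝ) • toPlane e] ?_
  intro i p ε hε
  have hlin : ∀ (c : ℝ) (x : Plane), basisCoord e u (p + ε • c • x) =
      basisCoord e u p + (ε * c) • basisCoord e u x := by
    intro c x
    have := basisCoord_combo (e := e) (u := u) 1 (ε * c) p x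
    rwa [one_smul, one_smul, mul_smul] at this
  have hpos := mul_pos hε ha2
  fin_cases i
  · simp only [triangleSide, Matrix.cons_val_zero, Fin.zero_eta, hlin, hu]
    simp
    nlinarith
  · simp only [triangleSide, Matrix.cons_val, Fin.mk_one, hlin, he]
    simp
    nlinarith
  · simp only [triangleSide, Matrix.cons_val, Fin.reduceFinMk, hlin, he]
    simp
    nlinarith

/-- The explicit sum counts the lattice points inside the triangle row by row. -/
lemma triangleSum_eq_ncard (h : cross e u = 1) {g : ℕ} (hg : 0 < g) {α β : ℝ} (hα : α ≠ 0)
    {w q : Plane} (hw : basisCoord e u w = !₂[(g : ℝ), 0]) (hq : basisCoord e u q = !₂[β, -α]) :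
    triangleSum α β g =
      (({x : LatVec | toPlane x ∈ interior (convexHull ℝ {0, w, q})}.ncard : ℕ) : ℝ) := by
  have hgR : (0 : ℝ) < g := by exact_mod_cast hg
  rw [interior_triangle h hgR (neg_ne_zero.2 hα) hw hq, triangleSum, if_neg hα]
  -- `ε` is the sign of the height of the apex
  obtain ⟨ε, hε, hαε⟩ : ∃ ε : ℤ, ε * ε = 1 ∧ -α = ε * |α| := by
    rcases abs_cases α with ⟨h1, -⟩ | ⟨h1, -⟩
    · exact ⟨-1, by norm_num, by rw [h1]; push_cast; ring⟩
    · exact ⟨1, by norm_num, by rw [h1]; push_cast; ring⟩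
  have hεR : (ε : ℝ) * ε = 1 := by exact_mod_cast hε
  have hd : 0 < |α| := abs_pos.2 hα
  rw [hαε]
  generalize |α| = d at *
  clear hαε hα hq
  have hceil : 0 < ⌈d⌉ := Int.ceil_pos.2 hd
  let S : Finset (Σ _ : ℤ, ℤ) := (Finset.Icc 1 (⌈d⌉ - 1)).sigma
    fun j => Finset.Icc (⌊β / d * (j : ℝ)⌋ + 1) (g + ⌈(β - ((g : ℤ) : ℝ)) / d * (j : ℝ)⌉ - 1)
  have hiff : ∀ x : LatVec, (∀ i, 0 < triangleSide e u g β (ε * d) i (toPlane x)) ↔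
      (⟨ε * latCoord e u x 1, latCoord e u x 0⟩ : Σ _ : ℤ, ℤ) ∈ S := by
    intro x
    have hsq : ((ε : ℝ) * d) ^ 2 = d ^ 2 := by rw [mul_pow, sq (ε : ℝ), hεR, one_mul]
    rw [Fin.forall_fin_succ, Fin.forall_fin_two]
    simp only [triangleSide, Matrix.cons_val_zero, Matrix.cons_val_one, Matrix.cons_val_succ,
      Fin.succ_zero_eq_one, basisCoord_toPlane, toPlane_apply, hsq]
    simp only [S, Finset.mem_sigma, Finset.mem_Icc]
    have hj : (ε : ℝ) * d * (latCoord e u x 1 : ℝ) = d * ((ε * latCoord e u x 1 : ℤ) : ℝ) := by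
      push_cast; ring
    rw [hj]
    generalize ε * latCoord e u x 1 = j
    generalize latCoord e u x 0 = s
    have e1 : 0 < d * (j : ℝ) ↔ 1 ≤ j := by
      rw [mul_pos_iff_of_pos_left hd]
      constructor
      · intro h; have : 0 < j := by exact_mod_cast h
        omega
      · intro h; exact_mod_cast (by omega : 0 < j)
    have e2 : 0 < d ^ 2 * (s : ℝ) - β * (d * (j : ℝ)) ↔ ⌊β / d * (j : ℝ)⌋ + 1 ≤ s := by
      rw [Int.add_one_le_iff, Int.floor_lt, div_mul_eq_mul_div, div_lt_iff₀ hd, sub_pos]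
      constructor
      · intro h; nlinarith
      · intro h; nlinarith
    have e3 : 0 < d ^ 2 * ((g : ℝ) - s) + (β - g) * (d * (j : ℝ)) ↔
        s ≤ g + ⌈(β - ((g : ℤ) : ℝ)) / d * (j : ℝ)⌉ - 1 := by
      have : s ≤ g + ⌈(β - ((g : ℤ) : ℝ)) / d * (j : ℝ)⌉ - 1 ↔
          s - g < ⌈(β - ((g : ℤ) : ℝ)) / d * (j : ℝ)⌉ := by omega
      rw [this, Int.lt_ceil, div_mul_eq_mul_div, lt_div_iff₀ hd]
      push_cast
      constructor
      · intro h; nlinarith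
      · intro h; nlinarith
    rw [e1, e2, e3]
    constructor
    · rintro ⟨h1, h2, h3⟩
      refine ⟨⟨h1, ?_⟩, h2, h3⟩
      have h2' := e2.2 h2
      have h3' := e3.2 h3
      have : 0 < g * d * (d - j) := by nlinarith
      have : 0 < d - j := pos_of_mul_pos_right this (by positivity)
      have : j < ⌈d⌉ := Int.lt_ceil.2 (by linarith)
      omega
    · rintro ⟨⟨h1, -⟩, h2, h3⟩
      exact ⟨h1, h2, h3⟩
  have hcard : {x : LatVec | toPlane x ∈ {p | ∀ i, 0 < triangleSide e u g β (ε * d) i p}}.ncard =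
      S.card := by
    rw [← Set.ncard_coe_finset]
    refine Set.ncard_congr (fun x _ => ⟨ε * latCoord e u x 1, latCoord e u x 0⟩) ?_ ?_ ?_
    · intro x hx
      exact (hiff x).1 hx
    · intro x y _ _ hxy
      apply latCoord_injective h
      simp only [Sigma.mk.injEq, heq_eq_eq] at hxy
      ext k; fin_cases k
      · exact hxy.2
      · have h1 := congrArg (ε * ·) hxy.1
        simp only [← mul_assoc, hε, one_mul] at h1
        exact h1
    · rintro ⟨j, s⟩ hjs
      obtain ⟨x, hx⟩ := latCoord_surjective h ![s, ε * j]
      have e1 : (⟨ε * latCoord e u x 1, latCoord e u x 0⟩ : Σ _ : ℤ, ℤ) = ⟨j, s⟩ := by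
        rw [hx]
        simp [← mul_assoc, hε]
      exact ⟨x, (hiff x).2 (e1 ▸ hjs), e1⟩
  rw [hcard, Finset.card_sigma, ← Int.cast_natCast (R := ℝ), Int.cast_inj]
  have hI : ((⌈d⌉ - 1) : ℤ) * ((g : ℤ) - 1) = ∑ j ∈ Finset.Icc 1 (⌈d⌉ - 1), ((g : ℤ) - 1) := by
    rw [Finset.sum_const, Int.card_Icc, nsmul_eq_mul, Int.toNat_of_nonneg (by omega)]
    ring
  rw [hI, ← Finset.sum_add_distrib]
  push_cast
  refine Finset.sum_congr rfl fun j hj => ?_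
  rw [Finset.mem_Icc] at hj
  have hjd : (j : ℝ) < d := Int.lt_ceil.1 (by omega)
  have h1 := Int.floor_le (β / d * (j : ℝ))
  have h2 := Int.le_ceil ((β - (g : ℝ)) / d * (j : ℝ))
  have h3 : (⌊β / d * (j : ℝ)⌋ : ℝ) < g + ⌈(β - (g : ℝ)) / d * (j : ℝ)⌉ := by
    have : (β - (g : ℝ)) / d * (j : ℝ) = β / d * j - g * (j / d) := by ring
    have : (j : ℝ) / d < 1 := (div_lt_one hd).2 hjd
    nlinarith
  have h3' : ⌊β / d * (j : ℝ)⌋ < g + ⌈(β - (g : ℝ)) / d * (j : ℝ)⌉ := by exact_mod_cast h3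
  rw [Int.card_Icc]
  omega

end Triangle

/-! ### Bonds in an arbitrary direction -/

variable {e u w : LatVec}

lemma latCoord_sub (x y : LatVec) : latCoord e u (x - y) = latCoord e u x - latCoord e u y := by
  ext k; fin_cases k <;> simp [latCoord, cross] <;> ring

lemma latCoord_add (x y : LatVec) : latCoord e u (x + y) = latCoord e u x + latCoord e u y := by
  ext k; fin_cases k <;> simp [latCoord, cross] <;> ring

lemma cross_latCoord (h : cross e u = 1) (x y : LatVec) :
    cross (latCoord e u x) (latCoord e u y) = cross x y := by
  rw [cross] at h
  simp only [latCoord, cross, Matrix.cons_val_zero, Matrix.cons_val_one]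
  linear_combination (x 0 * y 1 - x 1 * y 0) * h

/-- The linear map that takes coordinates with respect to `e`, `u`. -/
noncomputable def basisCoordLinear (e u : LatVec) : Plane →ₗ[ℝ] Plane where
  toFun := basisCoord e u
  map_add' p q := by simpa using basisCoord_combo (e := e) (u := u) 1 1 p q
  map_smul' a p := by simpa using basisCoord_combo (e := e) (u := u) a 0 p 0

lemma region_latCoord : region (fun i => latCoord e u (v i)) = basisCoord e u '' region v := by
  have := (basisCoordLinear e u).image_convexHull (Set.range fun i => toPlane (v i))
  rw [← Set.range_comp] at this
  rw [region, region]
  refine Eq.trans ?_ this.symm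
  congr 2
  ext1 i
  exact (basisCoord_toPlane _).symm

lemma facet_latCoord (i : ZMod N) :
    facet (fun i => latCoord e u (v i)) i = basisCoord e u '' facet v i := by
  have := image_segment ℝ (basisCoordLinear e u).toAffineMap (toPlane (v i)) (toPlane (v (i + 1)))
  rw [facet, ← basisCoord_toPlane, ← basisCoord_toPlane]
  exact this.symm

lemma mem_region_latCoord (h : cross e u = 1) {p : Plane} :
    basisCoord e u p ∈ region (fun i => latCoord e u (v i)) ↔ p ∈ region v := by
  rw [region_latCoord]
  exact (basisCoord_injective h).mem_set_image

lemma mem_facet_latCoord (h : cross e u = 1) {p : Plane} {i : ZMod N} :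
    basisCoord e u p ∈ facet (fun i => latCoord e u (v i)) i ↔ p ∈ facet v i := by
  rw [facet_latCoord]
  exact (basisCoord_injective h).mem_set_image

lemma IsConvexLatticePolygon.latCoord (hv : IsConvexLatticePolygon v) (h : cross e u = 1) :
    IsConvexLatticePolygon fun i => latCoord e u (v i) := by
  refine ⟨hv.1, fun i j h1 h2 => ?_⟩
  rw [← latCoord_sub, ← latCoord_sub, cross_latCoord h]
  exact hv.2 i j h1 h2

lemma ShortBond.latCoord (hb : ShortBond v w) (h : cross e u = 1) :
    ShortBond (fun i => latCoord e u (v i)) (latCoord e u w) := by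
  intro k j c h1 h2
  rw [← basisCoord_toPlane, mem_facet_latCoord h] at h1
  refine hb k j c h1 ?_
  rw [← mem_facet_latCoord h]
  have := basisCoord_combo (e := e) (u := u) 1 c (toPlane (v k)) (toPlane w)
  rw [one_smul, one_smul, basisCoord_toPlane, basisCoord_toPlane] at this
  rwa [this]

lemma shortBond_of_norm_lt [NeZero N] (h : ‖toPlane w‖ < delta v) : ShortBond v w := by
  intro k j c h1 h2
  have hle : delta v ≤ |c| * ‖toPlane w‖ := by
    refine (ciInf_le (Set.finite_range _).bddBelow ⟨(k, j), h1⟩).trans ?_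
    refine (Metric.infDist_le_dist_of_mem h2).trans ?_
    rw [dist_eq_norm, sub_add_cancel_left, norm_neg, norm_smul, Real.norm_eq_abs]
  by_contra! hc
  nlinarith [norm_nonneg (toPlane w)]

/-- The number of bonds parallel to `w` in the polygon. -/
noncomputable def bondCount (v : ZMod N → LatVec) (w : LatVec) : ℕ :=
  {x : LatVec | toPlane x ∈ region v ∧ toPlane (x + w) ∈ region v}.ncard

lemma bondCount_latCoord (h : cross e u = 1) (w : LatVec) :
    bondCount (fun i => latCoord e u (v i)) (latCoord e u w) = bondCount v w := by
  symm
  refine Set.ncard_congr (fun x _ => latCoord e u x) ?_ ?_ ?_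
  · rintro x ⟨h1, h2⟩
    refine ⟨?_, ?_⟩
    · rwa [← basisCoord_toPlane, mem_region_latCoord h]
    · rwa [← latCoord_add, ← basisCoord_toPlane, mem_region_latCoord h]
  · intro x y _ _ hxy
    exact latCoord_injective h hxy
  · rintro y ⟨h1, h2⟩
    obtain ⟨x, rfl⟩ := latCoord_surjective h y
    rw [← basisCoord_toPlane, mem_region_latCoord h] at h1
    rw [← latCoord_add, ← basisCoord_toPlane, mem_region_latCoord h] at h2
    exact ⟨x, ⟨h1, h2⟩, rfl⟩

/-- Pick's theorem. -/
lemma IsConvexLatticePolygon.pick [NeZero N] (hv : IsConvexLatticePolygon v) :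
    (bondCount v 0 : ℝ) =
      volume.real (region v) + (∑ i, (latGcd (v (i + 1) - v i) : ℝ)) / 2 + 1 := by
  have h1 := hv.ncard_shift 0
  have h2 : (![((0 : ℕ) : ℤ), 0] : LatVec) = 0 := by ext k; fin_cases k <;> rfl
  rw [h2] at h1
  have h3 : ∀ t ∈ Finset.Icc (lowest v) (highest v),
      max (rowCount v t - ((0 : ℕ) : ℤ)) 0 = rowCount v t := by
    intro t ht
    rw [Finset.mem_Icc] at ht
    have := le_rowCount (v := v) (g := 0) (t := t) (by
      rw [Nat.cast_zero, sub_nonneg]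
      exact hv.leftEnd_le_rightEnd (by exact_mod_cast ht.1) (by exact_mod_cast ht.2))
    rw [Nat.cast_zero, sub_zero]
    exact max_eq_left (by exact_mod_cast this)
  rw [Finset.sum_congr rfl h3] at h1
  have h4 : (bondCount v 0 : ℝ) = ∑ t ∈ Finset.Icc (lowest v) (highest v), (rowCount v t : ℝ) := by
    rw [bondCount]; exact_mod_cast h1
  have h5 := hv.two_mul_sum_rowCount
  rw [← hv.two_mul_area] at h5
  linarith

lemma cross_eq_gcd_mul (w x : LatVec) : cross w x = latGcd w * cross (prim w) x := by
  rw [cross, ← latGcd_mul_prim w 0, ← latGcd_mul_prim w 1, cross]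
  ring

lemma latCoord_self (h : cross (prim w) u = 1) : latCoord (prim w) u w = ![(latGcd w : ℤ), 0] := by
  have h1 : cross (prim w) w = 0 := by
    rw [cross, ← latGcd_mul_prim w 0, ← latGcd_mul_prim w 1]; ring
  rw [latCoord, h1, cross_eq_gcd_mul w u, h, mul_one]

/-- The number of bonds parallel to `w`: each of the lattice lines parallel to `w` that meet the
polygon loses `gcd w` points, except that a line with fewer points has none to lose. -/
lemma IsConvexLatticePolygon.bondCount_eq [NeZero N] (hv : IsConvexLatticePolygon v) (hw : w ≠ 0)
    (hb : ShortBond v w) (h : cross (prim w) u = 1) :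
    (bondCount v w : ℝ) = volume.real (region v) +
      (∑ i, ((latGcd (v (i + 1) - v i) : ℝ) - |(cross w (v (i + 1) - v i) : ℝ)|)) / 2 +
      1 - latGcd w +
      ∑ i, if (cross (prim w) (v i - v (i - 1)) * cross (prim w) (v (i + 1) - v i) : ℤ) < 0 then
        (latGcd w : ℝ) - 1 + tipSum (fun i => BondCounting.latCoord (prim w) u (v i)) (latGcd w) i
        else 0 := by
  set v' : ZMod N → LatVec := fun i => BondCounting.latCoord (prim w) u (v i) with hv'def
  have hv' : IsConvexLatticePolygon v' := hv.latCoord h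
  have hg := latGcd_pos hw
  have hb' : ShortBond v' ![(latGcd w : ℤ), 0] := by
    rw [← latCoord_self h]; exact hb.latCoord h
  have hsub : ∀ i j, (v' i - v' j) 1 = cross (prim w) (v i - v j) := by
    intro i j
    rw [hv'def, ← latCoord_sub]; rfl
  -- all lattice points
  have h0 : (bondCount v 0 : ℝ) =
      ∑ t ∈ Finset.Icc (lowest v') (highest v'), (rowCount v' t : ℝ) := by
    have e1 := hv'.pick
    have e2 := hv'.two_mul_sum_rowCount
    rw [← hv'.two_mul_area] at e2
    have e3 : bondCount v' 0 = bondCount v 0 := by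
      have hz : BondCounting.latCoord (prim w) u 0 = 0 := by
        ext k; fin_cases k <;> simp [BondCounting.latCoord, cross]
      rw [← bondCount_latCoord (v := v) h 0, hz]
    rw [← e3]
    linarith
  have h1 : (bondCount v w : ℝ) = ∑ t ∈ Finset.Icc (lowest v') (highest v'),
      max ((rowCount v' t : ℝ) - latGcd w) 0 := by
    rw [← bondCount_latCoord h w, latCoord_self h]
    have := hv'.ncard_shift (latGcd w)
    rw [bondCount]
    exact_mod_cast this
  have h2 : ∀ t : ℤ, max ((rowCount v' t : ℝ) - latGcd w) 0 =
      (rowCount v' t - latGcd w) + max ((latGcd w : ℝ) - rowCount v' t) 0 := by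
    intro t
    rcases le_total (rowCount v' t : ℝ) (latGcd w) with h | h
    · rw [max_eq_right (by linarith), max_eq_left (by linarith)]; ring
    · rw [max_eq_left (by linarith), max_eq_right (by linarith)]; ring
  have h3 : 2 * ((highest v' : ℝ) - lowest v') * latGcd w =
      ∑ i, |(cross w (v (i + 1) - v i) : ℝ)| := by
    have := hv'.sum_abs_height
    have h4 : ((∑ i, |v' (i + 1) 1 - v' i 1| : ℤ) : ℝ) = ((2 * (highest v' - lowest v') : ℤ) : ℝ) := by
      rw [this]
    push_cast at h4
    rw [← h4, Finset.sum_mul]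
    refine Finset.sum_congr rfl fun i _ => ?_
    rw [cross_eq_gcd_mul w, ← hsub, Pi.sub_apply]
    push_cast
    rw [abs_mul, Nat.abs_cast, mul_comm]
  rw [h1, Finset.sum_congr rfl fun t _ => h2 t, Finset.sum_add_distrib, Finset.sum_sub_distrib,
    ← h0, hv.pick, hv'.sum_deficit hg hb', Finset.sum_const, Int.card_Icc, nsmul_eq_mul,
    Finset.sum_sub_distrib, ← h3, ← Int.cast_natCast (R := ℝ) (Int.toNat _),
    Int.toNat_of_nonneg (by have := hv'.lowest_lt_highest; omega)]
  simp only [hsub]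
  push_cast
  ring

/-! ### The vertex terms -/

lemma inner_plane (p q : Plane) : inner ℝ p q = p 0 * q 0 + p 1 * q 1 := by
  simp [PiLp.inner_apply, Fin.sum_univ_two, mul_comm]

lemma inner_unitNormal (hv : IsConvexLatticePolygon v) (i : ZMod N) :
    ∃ c > (0 : ℝ), unitNormal v i = c • perp (toPlane (v (i + 1) - v i)) ∧
      ∀ w, inner ℝ (toPlane w) (unitNormal v i) = c * cross w (v (i + 1) - v i) := by
  obtain ⟨c, hc, h⟩ := exists_unitNormal_eq hv i
  refine ⟨c, hc, h, fun w => ?_⟩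
  rw [h, inner_plane]
  simp [perp, cross]
  ring

lemma inner_mul_inner_neg_iff (hv : IsConvexLatticePolygon v) (hw : w ≠ 0) (i : ZMod N) :
    inner ℝ (toPlane w) (unitNormal v i) * inner ℝ (toPlane w) (unitNormal v (i - 1)) < 0 ↔
      cross (prim w) (v i - v (i - 1)) * cross (prim w) (v (i + 1) - v i) < 0 := by
  obtain ⟨c, hc, -, h1⟩ := inner_unitNormal hv i
  obtain ⟨c', hc', -, h2⟩ := inner_unitNormal hv (i - 1)
  have hg : (0 : ℝ) < latGcd w := by exact_mod_cast latGcd_pos hw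
  rw [h1, h2, sub_add_cancel, cross_eq_gcd_mul w, cross_eq_gcd_mul w, ← Int.cast_lt (R := ℝ)]
  push_cast
  have : c * (latGcd w * (cross (prim w) (v (i + 1) - v i) : ℝ)) *
      (c' * (latGcd w * (cross (prim w) (v i - v (i - 1)) : ℝ))) =
      (c * c' * latGcd w * latGcd w) * (cross (prim w) (v i - v (i - 1)) *
        cross (prim w) (v (i + 1) - v i)) := by ring
  rw [this, ← neg_pos, ← mul_neg, mul_pos_iff_of_pos_left (by positivity), neg_pos]

/-- The apex of the triangle lies on the line through the origin parallel to the facet `S_i`. -/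
lemma apex_unitNormal (hv : IsConvexLatticePolygon v) (i : ZMod N) :
    apex w (unitNormal v i) (unitNormal v (i - 1)) =
      (-(latGcd w * cross (prim w) (v i - v (i - 1)) /
        cross (v i - v (i - 1)) (v (i + 1) - v i) : ℝ)) • toPlane (v (i + 1) - v i) := by
  obtain ⟨c, hc, h1, -⟩ := inner_unitNormal hv i
  obtain ⟨c', hc', h2, h3⟩ := inner_unitNormal hv (i - 1)
  have hC : (cross (v i - v (i - 1)) (v (i + 1) - v i) : ℝ) ≠ 0 := by
    exact_mod_cast (hv.cross_pos i).ne'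
  have hperp : perp (unitNormal v i) = (-c) • toPlane (v (i + 1) - v i) := by
    rw [h1]; apply plane_ext <;> simp [perp]; ring
  have hden : inner ℝ (unitNormal v (i - 1)) (perp (unitNormal v i)) =
      c' * c * cross (v i - v (i - 1)) (v (i + 1) - v i) := by
    rw [hperp, inner_smul_right, real_inner_comm, h3, sub_add_cancel]
    simp only [cross, Pi.sub_apply]
    push_cast
    ring
  rw [apex, real_inner_comm, h3, hden, hperp, smul_smul, sub_add_cancel, cross_eq_gcd_mul w]
  congr 1
  push_cast
  field_simp

lemma basisCoord_eq (q : Plane) : basisCoord e u q =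
    !₂[inner ℝ q (toPlane (latPerp u)), -inner ℝ q (toPlane (latPerp e))] := by
  apply plane_ext <;> simp [inner_plane, basisCoord, latPerp] <;> ring

lemma inner_apex_prim (hv : IsConvexLatticePolygon v) (i : ZMod N) :
    inner ℝ (apex w (unitNormal v i) (unitNormal v (i - 1))) (toPlane (latPerp (prim w))) =
      latGcd w * cross (prim w) (v i - v (i - 1)) * cross (prim w) (v (i + 1) - v i) /
        cross (v i - v (i - 1)) (v (i + 1) - v i) := by
  have : inner ℝ (toPlane (v (i + 1) - v i)) (toPlane (latPerp (prim w))) =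
      -(cross (prim w) (v (i + 1) - v i) : ℝ) := by
    rw [inner_plane]; simp [latPerp, cross]; ring
  rw [apex_unitNormal hv, real_inner_smul_left, this]
  ring

lemma inner_apex_compl (hv : IsConvexLatticePolygon v) (i : ZMod N) :
    inner ℝ (apex w (unitNormal v i) (unitNormal v (i - 1))) (toPlane (latPerp u)) =
      -(latGcd w * cross (prim w) (v i - v (i - 1)) * cross (v (i + 1) - v i) u /
        cross (v i - v (i - 1)) (v (i + 1) - v i) : ℝ) := by
  have : inner ℝ (toPlane (v (i + 1) - v i)) (toPlane (latPerp u)) =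
      (cross (v (i + 1) - v i) u : ℝ) := by
    rw [inner_plane]; simp [latPerp, cross]; ring
  rw [apex_unitNormal hv, real_inner_smul_left, this]
  ring

lemma triangleCount_eq_tipSum (hv : IsConvexLatticePolygon v) (h : cross (prim w) u = 1)
    (i : ZMod N) :
    triangleCount u w (unitNormal v i) (unitNormal v (i - 1)) =
      tipSum (fun i => latCoord (prim w) u (v i)) (latGcd w) i := by
  rw [triangleCount, tipSum, inner_apex_prim hv, inner_apex_compl hv, ← latCoord_sub,
    ← latCoord_sub, cross_latCoord h]
  rfl

lemma triangleCount_eq_ncard (hv : IsConvexLatticePolygon v) (hw : w ≠ 0)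
    (h : cross (prim w) u = 1) {i : ZMod N}
    (hneg : inner ℝ (toPlane w) (unitNormal v i) * inner ℝ (toPlane w) (unitNormal v (i - 1)) < 0) :
    triangleCount u w (unitNormal v i) (unitNormal v (i - 1)) =
      (({x : LatVec | toPlane x ∈
        interior (triangle w (unitNormal v i) (unitNormal v (i - 1)))}.ncard : ℕ) : ℝ) := by
  rw [inner_mul_inner_neg_iff hv hw] at hneg
  have hg := latGcd_pos hw
  refine triangleSum_eq_ncard h hg ?_ ?_ (basisCoord_eq _)
  · rw [inner_apex_prim hv]
    have hneg' : ((cross (prim w) (v i - v (i - 1)) : ℝ) * cross (prim w) (v (i + 1) - v i)) ≠ 0 := by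
      exact_mod_cast hneg.ne
    have hC : (cross (v i - v (i - 1)) (v (i + 1) - v i) : ℝ) ≠ 0 := by
      exact_mod_cast (hv.cross_pos i).ne'
    have hgR : (latGcd w : ℝ) ≠ 0 := by exact_mod_cast hg.ne'
    rw [mul_assoc]
    exact div_ne_zero (mul_ne_zero hgR hneg') hC
  · rw [basisCoord_toPlane, latCoord_self h]
    apply plane_ext <;> simp

/-! ### The energy -/

lemma energy_eq [NeZero N] (R : Finset LatVec) (φ : LatVec → ℝ → ℝ)
    (F : Matrix (Fin 2) (Fin 2) ℝ) :
    energy R φ F (region v) = 1 / 2 * ∑ w ∈ R, φ w (bondLength F w) * bondCount v w := by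
  classical
  rw [energy, finsum_mem_eq_finite_toFinset_sum _ (finite_lattice_region (v := v))]
  simp only [Finset.sum_filter]
  rw [Finset.sum_comm]
  congr 1
  refine Finset.sum_congr rfl fun w _ => ?_
  rw [← Finset.sum_filter, Finset.sum_const, nsmul_eq_mul, mul_comm, bondCount,
    ← Set.ncard_coe_finset]
  congr 3
  ext x
  simp

/-- The length of a facet in units of the length of its Miller normal. -/
lemma dist_eq_latGcd_mul_norm_miller (i : ZMod N) :
    dist (toPlane (v i)) (toPlane (v (i + 1))) =
      latGcd (v (i + 1) - v i) * ‖toPlane (miller v i)‖ := by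
  have hperp : ‖toPlane (miller v i)‖ = ‖toPlane (prim (v (i + 1) - v i))‖ := by
    rw [EuclideanSpace.norm_eq, EuclideanSpace.norm_eq]
    simp [miller, latPerp, Fin.sum_univ_two, add_comm]
  have : toPlane (v (i + 1)) - toPlane (v i) =
      (latGcd (v (i + 1) - v i) : ℝ) • toPlane (prim (v (i + 1) - v i)) := by
    have h := latGcd_mul_prim (v (i + 1) - v i)
    ext k
    have hk : ((latGcd (v (i + 1) - v i) * prim (v (i + 1) - v i) k : ℤ) : ℝ) =
      ((v (i + 1) - v i) k : ℤ) := by rw [h]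
    simp only [PiLp.sub_apply, PiLp.smul_apply, toPlane_apply, smul_eq_mul]
    rw [Pi.sub_apply] at hk
    push_cast at hk
    exact hk.symm
  rw [dist_comm, dist_eq_norm, this, norm_smul, hperp, Real.norm_eq_abs, Nat.abs_cast]

lemma latGcd_mul_abs_inner_miller (i : ZMod N) (w : LatVec) :
    latGcd (v (i + 1) - v i) * |inner ℝ (toPlane w) (toPlane (miller v i))| =
      |(cross w (v (i + 1) - v i) : ℝ)| := by
  rw [← Nat.abs_cast, ← abs_mul]
  congr 1
  have h := latGcd_mul_prim (v (i + 1) - v i)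
  rw [cross, ← h 0, ← h 1, inner_plane]
  simp [miller, latPerp]
  ring

/-- The energy formula for a single bond direction; all other parts of the formula are linear
in the values of `φ`. -/
lemma bondCount_eq_terms [NeZero N] (hv : IsConvexLatticePolygon v) (hw : w ≠ 0)
    (hb : ShortBond v w) (h : cross (prim w) u = 1) :
    (bondCount v w : ℝ) = volume.real (region v) +
      ∑ i, dist (toPlane (v i)) (toPlane (v (i + 1))) * (-(1 / 2) *
        (1 / ‖toPlane (miller v i)‖ * (|inner ℝ (toPlane w) (toPlane (miller v i))| - 1))) +
      ∑ i, ((sectorStep (unitNormal v i) (unitNormal v (i - 1)) w -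
        1 / (2 * Real.pi) * InnerProductGeometry.angle (unitNormal v i) (unitNormal v (i - 1))) *
        ((latGcd w : ℝ) - 1) + sectorStep (unitNormal v i) (unitNormal v (i - 1)) w *
        triangleCount u w (unitNormal v i) (unitNormal v (i - 1))) := by
  have h1 : ∀ i, dist (toPlane (v i)) (toPlane (v (i + 1))) * (-(1 / 2) *
        (1 / ‖toPlane (miller v i)‖ * (|inner ℝ (toPlane w) (toPlane (miller v i))| - 1))) =
        ((latGcd (v (i + 1) - v i) : ℝ) - |(cross w (v (i + 1) - v i) : ℝ)|) / 2 := by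
    intro i
    have hne : v (i + 1) - v i ≠ 0 := sub_ne_zero.2 (hv.ne_succ i).symm
    have hn : ‖toPlane (miller v i)‖ ≠ 0 :=
      (norm_toPlane_pos (latPerp_ne_zero (prim_ne_zero hne))).ne'
    rw [dist_eq_latGcd_mul_norm_miller, ← latGcd_mul_abs_inner_miller]
    field_simp
    ring
  have h2 : ∀ i, ((sectorStep (unitNormal v i) (unitNormal v (i - 1)) w -
        1 / (2 * Real.pi) * InnerProductGeometry.angle (unitNormal v i) (unitNormal v (i - 1))) *
        ((latGcd w : ℝ) - 1) + sectorStep (unitNormal v i) (unitNormal v (i - 1)) w *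
        triangleCount u w (unitNormal v i) (unitNormal v (i - 1))) =
      (if (cross (prim w) (v i - v (i - 1)) * cross (prim w) (v (i + 1) - v i) : ℤ) < 0 then
        (latGcd w : ℝ) - 1 + tipSum (fun i => latCoord (prim w) u (v i)) (latGcd w) i
        else 0) - ((latGcd w : ℝ) - 1) / (2 * Real.pi) *
        InnerProductGeometry.angle (unitNormal v i) (unitNormal v (i - 1)) := by
    intro i
    rw [sectorStep, triangleCount_eq_tipSum hv h]
    simp only [inner_mul_inner_neg_iff hv hw]
    split_ifs <;> ring
  rw [Finset.sum_congr rfl fun i _ => h1 i, Finset.sum_congr rfl fun i _ => h2 i,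
    Finset.sum_sub_distrib, ← Finset.mul_sum, hv.sum_angle, ← Finset.sum_div,
    hv.bondCount_eq hw hb h]
  have := Real.pi_ne_zero
  field_simp
  ring

end BondCounting

open BondCounting
theorem proposition1 {N : ℕ} [NeZero N] (v : ZMod N → LatVec) (hv : IsConvexLatticePolygon v)
    (R : Finset LatVec) (hR0 : (0 : LatVec) ∉ R) (hRsymm : ∀ w ∈ R, -w ∈ R)
    (hRdelta : ∀ w ∈ R, ‖toPlane w‖ < delta v)
    (φ : LatVec → ℝ → ℝ) (hφ : ∀ w ∈ R, ∀ r : ℝ, 0 < r → φ w r = φ (-w) r)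
    (F : Matrix (Fin 2) (Fin 2) ℝ) (hF : 0 < F.det)
    (u : LatVec → LatVec) (hu : ∀ w ∈ R, cross (prim w) (u w) = 1)
    (nbar : Plane → LatVec)
    (hnbar : ∀ i : ZMod N,
      ∀ x ∈ openSegment ℝ (toPlane (v i)) (toPlane (v (i + 1))), nbar x = miller v i) :
    energy R φ F (region v) =
        (∫ _x in region v, storedEnergy R φ F) +
        (∫ x in frontier (region v), surfaceDensity R φ F (nbar x)
          ∂(Measure.hausdorffMeasure 1 : Measure Plane)) +
        ∑ i : ZMod N, vertexEnergy R φ u F (unitNormal v i) (unitNormal v (i - 1)) ∧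
      ∀ i : ZMod N, ∀ w ∈ R,
        inner ℝ (toPlane w) (unitNormal v i) * inner ℝ (toPlane w) (unitNormal v (i - 1)) < 0 →
        triangleCount (u w) w (unitNormal v i) (unitNormal v (i - 1)) =
          (({x : LatVec | toPlane x ∈
            interior (triangle w (unitNormal v i) (unitNormal v (i - 1)))}.ncard : ℕ) : ℝ) := by
  have hne : ∀ w ∈ R, w ≠ 0 := fun w hw h => hR0 (h ▸ hw)
  refine ⟨?_, fun i w hw hneg => triangleCount_eq_ncard hv (hne w hw) (hu w hw) hneg⟩
  rw [hv.integral_frontier (fun x => surfaceDensity R φ F (nbar x))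
    (fun i => surfaceDensity R φ F (miller v i)) (fun i x hx => by rw [hnbar i x hx]),
    setIntegral_const, smul_eq_mul, energy_eq, storedEnergy, mul_left_comm, Finset.mul_sum]
  have h1 : ∑ i, dist (toPlane (v i)) (toPlane (v (i + 1))) *
      surfaceDensity R φ F (miller v i) =
      1 / 2 * ∑ w ∈ R, φ w (bondLength F w) *
        ∑ i, dist (toPlane (v i)) (toPlane (v (i + 1))) * (-(1 / 2) *
        (1 / ‖toPlane (miller v i)‖ * (|inner ℝ (toPlane w) (toPlane (miller v i))| - 1))) := by
    simp only [surfaceDensity, Finset.mul_sum]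
    rw [Finset.sum_comm]
    refine Finset.sum_congr rfl fun w _ => Finset.sum_congr rfl fun i _ => ?_
    ring
  have h2 : ∑ i, vertexEnergy R φ u F (unitNormal v i) (unitNormal v (i - 1)) =
      1 / 2 * ∑ w ∈ R, φ w (bondLength F w) *
        ∑ i, ((sectorStep (unitNormal v i) (unitNormal v (i - 1)) w -
        1 / (2 * Real.pi) * InnerProductGeometry.angle (unitNormal v i) (unitNormal v (i - 1))) *
        ((latGcd w : ℝ) - 1) + sectorStep (unitNormal v i) (unitNormal v (i - 1)) w *
        triangleCount (u w) w (unitNormal v i) (unitNormal v (i - 1))) := by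
    simp only [vertexEnergy, Finset.mul_sum]
    rw [Finset.sum_comm]
    refine Finset.sum_congr rfl fun w _ => Finset.sum_congr rfl fun i _ => ?_
    ring
  rw [h1, h2, Finset.mul_sum, ← Finset.mul_sum, ← mul_add, ← mul_add, ← Finset.sum_add_distrib,
    ← Finset.sum_add_distrib]
  congr 1
  refine Finset.sum_congr rfl fun w hw => ?_
  rw [bondCount_eq_terms hv (hne w hw) (shortBond_of_norm_lt (hRdelta w hw)) (hu w hw)]
  ring
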